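/- Let $\mathcal{B}=\mathbb{R}\oplus\tau\mathbb{R}$ be the real algebra with $\tau^2=1$, topologised as $\mathbb{R}^2$, and put $e^{\pm}=\frac{1\pm\tau}{2}$, $|a+\tau b|^2=a^2-b^2$ and $\mathcal{C}^+=\{a+\tau b \mid a>0,\ a^2-b^2>0\}$. Decomposing matrices as $A=A^+e^++A^-e^-$ identifies $\mathbb{P}SL(2,\mathcal{B})$ (the quotient of $SL(2,\mathcal{B})$ by its centre $\{\pm1,\pm\tau\}$) with $\mathbb{P}SL(2,\mathbb{R})\times\mathbb{P}SL(2,\mathbb{R})$. An element $A$ of $\mathbb{P}SL(2,\mathcal{B})$ is loxodromic if $A^+$ and $A^-$ are both hyperbolic, semi-loxodromic if one is hyperbolic and the other parabolic, and parabolic if both are parabolic. In these cases its $\mathcal{B}$-length is $$\ell_{\mathcal{B}}(A)=\frac{\ell(A^+)+\ell(A^-)}{2}+\tau\,\frac{\ell(A^+)-\ell(A^-)}{2},\qquad \ell(A^\pm)=2\,\mathrm{arccosh}\Big(\frac{|\mathrm{tr}(A^\pm)|}{2}\Big).$$ Let $\Gamma_{0,3}=\langle r,s,t\mid tsr=e\rangle$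 be the fundamental group of an oriented pair of pants $P$, each generator corresponding to a boundary curve of $P$ oriented so that $P$ lies on its left. A representation $\rho:\Gamma_{0,3}\to\mathbb{P}SL(2,\mathcal{B})$ is called admissible if $\rho(r),\rho(s),\rho(t)$ are each loxodromic, semi-loxodromic or parabolic, and both components $\rho^{+},\rho^{-}:\Gamma_{0,3}\to\mathbb{P}SL(2,\mathbb{R})$ are holonomies of hyperbolic structures on the oriented surface $P$. The latter means that $\rho^\pm$ is discrete and faithful and that, for each $x\in\{r,s,t\}$, one of the following holds: * $\rho^\pm(x)$ is hyperbolic, and the open half-plane $U\subset\mathbb{H}^2$ to the right of its axis (oriented from the repelling to the attracting fixed point) satisfies $\rho^\pm(y)U\cap U=\emptyset$ for all $y\in\Gamma_{0,3}\setminus\langle x\rangle$, so that $x$ is a boundary geodesic of the convex core of $\mathbb{H}^2/\rho^\pm(\Gamma_{0,3})$ with the core on its left; * $\rho^\pm(x)$ is parabolic and conjugate in $\mathbb{P}SL(2,\mathbb{R})$ to $z\mapsto z-1$, so that $x$ goes around a cusp with the cusp on its right. Let $\mathrm{Hom}^{adm}(\Gamma_{0,3},\mathbb{P}SL(2,\mathcal{B}))$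 be the set of admissible representations with the topology of pointwise convergence, and give its quotient by conjugation the quotient topology. Then the map $$F:\mathrm{Hom}^{adm}(\Gamma_{0,3},\mathbb{P}SL(2,\mathcal{B}))/\mathbb{P}SL(2,\mathcal{B})\longrightarrow\big(\overline{\mathcal{C}^+}\big)^3,\qquad [\rho]\mapsto\big(\ell_{\mathcal{B}}(\rho(r)),\ell_{\mathcal{B}}(\rho(s)),\ell_{\mathcal{B}}(\rho(t))\big)$$ is well defined and is a homeomorphism. -/

import Mathlib

open Topology

noncomputable section

namespace AdSPants

/-- The real algebra `𝓑 = ℝ ⊕ τℝ` with `τ² = 1`; `z.re` and `z.im` are the coordinates in the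
basis `1, τ`, and `QuadraticAlgebra.norm z = z.re ^ 2 - z.im ^ 2`. -/
abbrev BAlg : Type := QuadraticAlgebra ℝ 1 0

/-- The topology of `𝓑` as a two-dimensional real vector space. -/
instance : TopologicalSpace BAlg :=
  TopologicalSpace.induced (fun z : BAlg => (z.re, z.im)) inferInstance

/-- The coefficient of `e⁺ = (1 + τ) / 2` in the basis of idempotents `e⁺, e⁻`. -/
def coordPlus : BAlg →+* ℝ where
  toFun z := z.re + z.im
  map_one' := by simp [QuadraticAlgebra.re_one, QuadraticAlgebra.im_one]
  map_zero' := by simp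
  map_mul' x y := by simp [QuadraticAlgebra.re_mul, QuadraticAlgebra.im_mul]; ring
  map_add' x y := by simp; ring

/-- The coefficient of `e⁻ = (1 - τ) / 2` in the basis of idempotents `e⁺, e⁻`. -/
def coordMinus : BAlg →+* ℝ where
  toFun z := z.re - z.im
  map_one' := by simp [QuadraticAlgebra.re_one, QuadraticAlgebra.im_one]
  map_zero' := by simp
  map_mul' x y := by simp [QuadraticAlgebra.re_mul, QuadraticAlgebra.im_mul]; ring
  map_add' x y := by simp; ring

/-- `PSL(2, R) = SL(2, R) / center`. For `R = 𝓑` the center is `{±1, ±τ}`, so that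
`PSL(2, 𝓑)` is `PSL(2, ℝ) × PSL(2, ℝ)`. -/
abbrev PSL2 (R : Type) [CommRing R] : Type :=
  Matrix.SpecialLinearGroup (Fin 2) R ⧸ Subgroup.center (Matrix.SpecialLinearGroup (Fin 2) R)

/-- The class in `PSL(2, R)` of a matrix in `SL(2, R)`. -/
abbrev toPSL2 {R : Type} [CommRing R] (M : Matrix.SpecialLinearGroup (Fin 2) R) : PSL2 R :=
  QuotientGroup.mk M

theorem center_le_comap {R S : Type} [CommRing R] [CommRing S] (f : R →+* S) :
    Subgroup.center (Matrix.SpecialLinearGroup (Fin 2) R) ≤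
      (Subgroup.center (Matrix.SpecialLinearGroup (Fin 2) S)).comap
        (Matrix.SpecialLinearGroup.map f) := by
  intro M hM
  rw [Matrix.SpecialLinearGroup.mem_center_iff] at hM
  obtain ⟨c, hc, hM⟩ := hM
  rw [Subgroup.mem_comap, Matrix.SpecialLinearGroup.mem_center_iff]
  refine ⟨f c, by rw [← map_pow, hc, map_one], ?_⟩
  ext i j
  rw [Matrix.SpecialLinearGroup.map_apply_coe, ← hM]
  fin_cases i <;> fin_cases j <;> simp

/-- The homomorphism `PSL(2, R) → PSL(2, S)` given by a ring homomorphism `R → S`. -/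
def mapPSL2 {R S : Type} [CommRing R] [CommRing S] (f : R →+* S) : PSL2 R →* PSL2 S :=
  QuotientGroup.map _ _ (Matrix.SpecialLinearGroup.map f) (center_le_comap f)

/-- `A = A⁺ e⁺ + A⁻ e⁻ ↦ A⁺`. -/
def projPlus : PSL2 BAlg →* PSL2 ℝ := mapPSL2 coordPlus

/-- `A = A⁺ e⁺ + A⁻ e⁻ ↦ A⁻`. -/
def projMinus : PSL2 BAlg →* PSL2 ℝ := mapPSL2 coordMinus

/-- Hyperbolic elements of `PSL(2, ℝ)`. -/
def IsHyp (A : PSL2 ℝ) : Prop :=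
  ∃ M : Matrix.SpecialLinearGroup (Fin 2) ℝ, toPSL2 M = A ∧ M.1.IsHyperbolic

/-- Parabolic elements of `PSL(2, ℝ)` (the identity is not parabolic). -/
def IsPar (A : PSL2 ℝ) : Prop :=
  ∃ M : Matrix.SpecialLinearGroup (Fin 2) ℝ, toPSL2 M = A ∧ M.1.IsParabolic

/-- Loxodromic: a pair of hyperbolic elements. -/
def IsLoxodromic (A : PSL2 BAlg) : Prop := IsHyp (projPlus A) ∧ IsHyp (projMinus A)

/-- Semi-loxodromic: one hyperbolic and one parabolic element. -/
def IsSemiLoxodromic (A : PSL2 BAlg) : Prop :=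
  (IsHyp (projPlus A) ∧ IsPar (projMinus A)) ∨ (IsPar (projPlus A) ∧ IsHyp (projMinus A))

/-- Parabolic: a pair of parabolic elements. -/
def IsParabolicB (A : PSL2 BAlg) : Prop := IsPar (projPlus A) ∧ IsPar (projMinus A)

theorem abs_trace_eq_of_rel (M N : Matrix.SpecialLinearGroup (Fin 2) ℝ)
    (h : QuotientGroup.leftRel (Subgroup.center (Matrix.SpecialLinearGroup (Fin 2) ℝ)) M N) :
    |M.1.trace| = |N.1.trace| := by
  rw [QuotientGroup.leftRel_apply, Matrix.SpecialLinearGroup.mem_center_iff] at h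
  obtain ⟨c, hc, h⟩ := h
  have hN : N.1 = M.1 * Matrix.scalar (Fin 2) c := by
    rw [h, ← Matrix.SpecialLinearGroup.coe_mul, mul_inv_cancel_left]
  have hc' : |c| = 1 := by
    rw [Fintype.card_fin] at hc
    rcases (mul_self_eq_one_iff (a := c)).mp (by rw [← sq, hc]) with h | h <;> simp [h]
  rw [hN, Matrix.trace_fin_two, Matrix.trace_fin_two]
  simp [← add_mul, abs_mul, hc']

/-- The absolute value of the trace, on `PSL(2, ℝ)`. -/
def absTrace (A : PSL2 ℝ) : ℝ :=
  Quotient.lift (fun M : Matrix.SpecialLinearGroup (Fin 2) ℝ => |M.1.trace|)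
    abs_trace_eq_of_rel A

/-- The hyperbolic translation length `ℓ(A) = 2 arcosh (|tr A| / 2)` of a hyperbolic or parabolic
element; it is `0` in the parabolic case. -/
def hypLength (A : PSL2 ℝ) : ℝ := 2 * Real.arcosh (absTrace A / 2)

/-- The `𝓑`-length `(ℓ(A⁺) + ℓ(A⁻)) / 2 + τ (ℓ(A⁺) - ℓ(A⁻)) / 2 = 2 arcosh (tr A / 2)`. -/
def bLength (A : PSL2 BAlg) : BAlg :=
  ⟨(hypLength (projPlus A) + hypLength (projMinus A)) / 2,
    (hypLength (projPlus A) - hypLength (projMinus A)) / 2⟩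

/-- The cone `𝓒⁺` of space-like elements of `𝓑` with positive real part. -/
def conePlus : Set BAlg := {z | 0 < z.re ∧ 0 < QuadraticAlgebra.norm z}

/-- The relator `t s r`, where `r, s, t` are the generators `0, 1, 2`. -/
def pantsRels : Set (FreeGroup (Fin 3)) :=
  {FreeGroup.of 2 * FreeGroup.of 1 * FreeGroup.of 0}

/-- The fundamental group `⟨r, s, t | t s r = e⟩` of a pair of pants. -/
abbrev PantsGroup : Type := PresentedGroup pantsRels

/-- The generators `r = bdry 0`, `s = bdry 1`, `t = bdry 2`: the oriented boundary curves. -/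
def bdry (i : Fin 3) : PantsGroup := PresentedGroup.of i

/-- The matrix of the translation `z ↦ e^l z` of the upper half-plane; for `l > 0` its axis is the
imaginary half-line, oriented from the repelling point `0` to the attracting point `∞`. -/
def hypMat (l : ℝ) : Matrix.SpecialLinearGroup (Fin 2) ℝ :=
  ⟨!![Real.exp (l / 2), 0; 0, Real.exp (-(l / 2))], by
    rw [Matrix.det_fin_two_of, ← Real.exp_add]; simp⟩

/-- The matrix of the parabolic isometry `z ↦ z - 1` of the upper half-plane. -/
def parMat : Matrix.SpecialLinearGroup (Fin 2) ℝ :=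
  ⟨!![1, -1; 0, 1], by simp⟩

/-- For a representation `ρ` of `G` in `PSL(2, ℝ)` and `x : G`: the curve `x` is a boundary curve
of the quotient surface, oriented so that the surface lies on its left. That is, up to conjugation
in `PSL(2, ℝ)`, one of the following holds.
* `ρ x` is the hyperbolic isometry `z ↦ e^l z` with `l > 0`, and the open half-plane `Re z > 0` on
  the right of its oriented axis is precisely invariant: it is disjoint from its translates by the
  elements of `G` outside `⟨x⟩`. Hence this half-plane covers a funnel of the quotient, bounded by
  the closed geodesic `x`, and the convex core lies on the left of that geodesic.
* `ρ x` is the parabolic isometry `z ↦ z - 1`, which moves along the horocycles `Im z = c` with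
  the cusp `∞` on the right and the rest of the surface on the left. -/
def SurfaceOnLeft {G : Type} [Group G] (ρ : G →* PSL2 ℝ) (x : G) : Prop :=
  (∃ (P : Matrix.SpecialLinearGroup (Fin 2) ℝ) (l : ℝ), 0 < l ∧
    ρ x = toPSL2 (P * hypMat l * P⁻¹) ∧
    ∀ y : G, y ∉ Subgroup.zpowers x →
      ∀ M : Matrix.SpecialLinearGroup (Fin 2) ℝ, toPSL2 M = ρ y →
        ∀ z : UpperHalfPlane, 0 < (P⁻¹ • z).re → ¬ 0 < (P⁻¹ • (M • z)).re) ∨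
  (∃ P : Matrix.SpecialLinearGroup (Fin 2) ℝ, ρ x = toPSL2 (P * parMat * P⁻¹))

/-- Holonomies of hyperbolic structures on the oriented pair of pants with geodesic boundary
curves or cusps: discrete and faithful representations for which `r, s, t` are boundary curves of
the quotient surface, with the surface on the left of each of them. -/
structure IsPantsHolonomy (ρ : PantsGroup →* PSL2 ℝ) : Prop where
  faithful : Function.Injective ρ
  discrete : DiscreteTopology ρ.range
  left : ∀ i, SurfaceOnLeft ρ (bdry i)

/-- Admissible representations of the pants group in `PSL(2, 𝓑)`. -/
structure IsAdmissible (ρ : PantsGroup →* PSL2 BAlg) : Prop where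
  peripheral : ∀ i, IsLoxodromic (ρ (bdry i)) ∨ IsSemiLoxodromic (ρ (bdry i)) ∨
    IsParabolicB (ρ (bdry i))
  plus : IsPantsHolonomy (projPlus.comp ρ)
  minus : IsPantsHolonomy (projMinus.comp ρ)

/-- The set of admissible representations. -/
def AdmHom : Type := {ρ : PantsGroup →* PSL2 BAlg // IsAdmissible ρ}

/-- The topology of pointwise convergence. -/
instance : TopologicalSpace AdmHom :=
  TopologicalSpace.induced (fun (ρ : AdmHom) (x : PantsGroup) => ρ.1 x) inferInstance

/-- Conjugation by elements of `PSL(2, 𝓑)`. -/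
instance conjSetoid : Setoid AdmHom where
  r ρ σ := ∃ g : PSL2 BAlg, ∀ x, σ.1 x = g * ρ.1 x * g⁻¹
  iseqv :=
    { refl := fun _ => ⟨1, fun _ => by simp⟩
      symm := by
        rintro ρ σ ⟨g, h⟩
        exact ⟨g⁻¹, fun x => by rw [h x]; group⟩
      trans := by
        rintro ρ σ κ ⟨g, h⟩ ⟨k, h'⟩
        exact ⟨k * g, fun x => by rw [h' x, h x]; group⟩ }

/-- `Hom^adm(Γ_{0,3}, PSL(2, 𝓑)) / PSL(2, 𝓑)`, with the quotient topology. -/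
abbrev AdmModuli : Type := Quotient conjSetoid

end AdSPants

end

noncomputable section

namespace AdSPants

/-!
Let `ρ` be the holonomy of a hyperbolic structure with boundary lengths `L`, let `R`, `S`, `T` be
lifts to `SL(2, ℝ)`, with positive trace, of the images of `r`, `s`, `t`, and let `e` be an
eigenvector of `T` for the eigenvalue `exp (-L₂ / 2)`. As the surface lies on the left of `r` and
`s`, and `e` is fixed up to scale by an element outside `⟨r⟩` and `⟨s⟩`, the point at infinity given
by `e` does not border the half-planes on the right of `r` and `s` (and is not fixed by `r` or `s`
if these are parabolic), so that `R` and `S` turn `e` anticlockwise: `det (e, R e) > 0` and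
`det (e, S e) > 0`. Now `T = ± (S R)⁻¹`, and these signs exclude `+`. Hence
`S R e = - exp (L₂ / 2) e`, and in the positively oriented basis `e, R e` the matrices of `R` and
`S` are explicit functions of `L`.

Conversely, in this normal form the nontrivial powers of `r` map `{Re z ≥ 0}` into `{Re z < 0}`,
and those of `s` map `{Re z ≤ 0}` into `{Re z > 0}`. Ping-pong makes the representation discrete
and faithful, and makes the half-plane on the right of `r`, which is contained in `{Re z < 0}`,
precisely invariant. The automorphism `r ↦ s ↦ t ↦ r` carries normal forms to conjugates of normal
forms, with the lengths permuted, so the same is true of `s` and `t`.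

The splitting `𝓑 = ℝ e⁺ ⊕ ℝ e⁻` makes `PSL(2, 𝓑)` a product of two copies of `PSL(2, ℝ)` and the
closure of `𝓒⁺` a product of two closed half-lines, so the two components are independent. Since
the normal form depends continuously on `L`, it is a continuous inverse of the length map.
-/

/-! ### Actions of `SL(2)` and `PSL(2)` -/

/-- The group `SL(2, R)`. -/
abbrev SL2 (R : Type) [CommRing R] : Type := Matrix.SpecialLinearGroup (Fin 2) R

section CommRing

variable {R : Type} [CommRing R]

theorem SL2.smul_apply (M : SL2 R) (e : Fin 2 → R) (i : Fin 2) :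
    (M • e) i = M i 0 * e 0 + M i 1 * e 1 := by
  change (M.1.mulVec e) i = _
  rw [Matrix.mulVec, dotProduct, Fin.sum_univ_two]

theorem SL2.neg_smul (M : SL2 R) (e : Fin 2 → R) : -M • e = -(M • e) := by
  ext i
  simp only [SL2.smul_apply, Pi.neg_apply, Matrix.SpecialLinearGroup.coe_neg, Matrix.neg_apply]
  ring

theorem SL2.det_eq_one (M : SL2 R) : M 0 0 * M 1 1 - M 0 1 * M 1 0 = 1 := by
  rw [← Matrix.det_fin_two, M.det_coe]

theorem SL2.inv_eq (M : SL2 R) : (M⁻¹).1 = !![M 1 1, -M 0 1; -M 1 0, M 0 0] := by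
  rw [Matrix.SpecialLinearGroup.coe_inv, Matrix.adjugate_fin_two]

theorem SL2.trace_inv (M : SL2 R) : (M⁻¹).1.trace = M.1.trace := by
  rw [Matrix.trace_fin_two, Matrix.trace_fin_two, SL2.inv_eq]
  exact add_comm _ _

theorem SL2.smul_add_inv_smul (M : SL2 R) (e : Fin 2 → R) :
    M • e + M⁻¹ • e = M.1.trace • e := by
  rw [Matrix.trace_fin_two]
  ext i
  rw [Pi.add_apply, Pi.smul_apply, SL2.smul_apply, SL2.smul_apply, SL2.inv_eq, smul_eq_mul]
  fin_cases i <;>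
    simp only [Matrix.of_apply, Matrix.cons_val', Matrix.cons_val_fin_one, Fin.zero_eta, Fin.mk_one,
      Matrix.cons_val_zero, Matrix.cons_val_one] <;>
    ring

theorem SL2.trace_conj (P M : SL2 R) : (P * M * P⁻¹).1.trace = M.1.trace := by
  rw [Matrix.SpecialLinearGroup.coe_mul, Matrix.trace_mul_comm,
    ← Matrix.SpecialLinearGroup.coe_mul, ← mul_assoc, inv_mul_cancel, one_mul]

/-- The area form `(e, f) ↦ e₀ f₁ - e₁ f₀`, that is, the determinant with columns `e` and `f`. -/
def area (e f : Fin 2 → R) : R := e 0 * f 1 - e 1 * f 0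

theorem area_smul_smul (M : SL2 R) (e f : Fin 2 → R) : area (M • e) (M • f) = area e f := by
  simp only [area, SL2.smul_apply]
  linear_combination (e 0 * f 1 - e 1 * f 0) * M.det_eq_one

theorem toPSL2_eq_iff [NoZeroDivisors R] {M N : SL2 R} :
    toPSL2 M = toPSL2 N ↔ N = M ∨ N = -M := by
  rw [QuotientGroup.eq, Matrix.SpecialLinearGroup.mem_center_iff]
  constructor
  · rintro ⟨c, hc, h⟩
    have hN : N.1 = M.1 * Matrix.scalar (Fin 2) c := by
      rw [h, ← Matrix.SpecialLinearGroup.coe_mul, mul_inv_cancel_left]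
    rw [Fintype.card_fin, sq, mul_self_eq_one_iff] at hc
    rcases hc with rfl | rfl
    · left; ext i j; simp [hN]
    · right; ext i j; simp [hN]
  · rintro (rfl | rfl)
    · exact ⟨1, by simp, by simp⟩
    · exact ⟨-1, by simp, by ext i j; fin_cases i <;> fin_cases j <;> simp⟩

end CommRing

theorem toPSL2_neg {R : Type} [CommRing R] [NoZeroDivisors R] (M : SL2 R) :
    toPSL2 (-M) = toPSL2 M :=
  toPSL2_eq_iff.2 (.inr (neg_neg M).symm)

theorem exists_eq_conj_of_area_pos {e f : Fin 2 → ℝ} (hef : 0 < area e f) :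
    ∃ (P : SL2 ℝ) (k : ℝ), 0 < k ∧ (∀ i, P i 0 = k * e i) ∧ (∀ i, P i 1 = k * f i) ∧
      ∀ M N : SL2 ℝ, M • e = N 0 0 • e + N 1 0 • f → M • f = N 0 1 • e + N 1 1 • f →
        M = P * N * P⁻¹ := by
  set k := (√(area e f))⁻¹
  have hk : 0 < k := inv_pos.2 (Real.sqrt_pos.2 hef)
  have hk2 : k ^ 2 * area e f = 1 := by
    rw [inv_pow, Real.sq_sqrt hef.le, inv_mul_cancel₀ hef.ne']
  obtain ⟨P, hP⟩ : ∃ P : SL2 ℝ, P.1 = !![k * e 0, k * f 0; k * e 1, k * f 1] :=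
    ⟨⟨_, by rw [Matrix.det_fin_two_of, ← hk2, area]; ring⟩, rfl⟩
  have hPe (i : Fin 2) : P i 0 = k * e i := by fin_cases i <;> simp [hP]
  have hPf (i : Fin 2) : P i 1 = k * f i := by fin_cases i <;> simp [hP]
  refine ⟨P, k, hk, hPe, hPf, fun M N he hf => ?_⟩
  rw [eq_mul_inv_iff_mul_eq]
  ext i j
  have hei := congrFun he i
  have hfi := congrFun hf i
  simp only [SL2.smul_apply, Pi.add_apply, Pi.smul_apply, smul_eq_mul] at hei hfi
  rw [Matrix.SpecialLinearGroup.coe_mul, Matrix.SpecialLinearGroup.coe_mul, Matrix.mul_apply,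
    Matrix.mul_apply, Fin.sum_univ_two, Fin.sum_univ_two]
  fin_cases j <;> simp only [Fin.zero_eta, Fin.mk_one, hPe, hPf]
  · linear_combination k * hei
  · linear_combination k * hfi

theorem center_le_ker_toPermHom :
    Subgroup.center (SL2 ℝ) ≤ (MulAction.toPermHom (SL2 ℝ) UpperHalfPlane).ker := by
  intro M hM
  obtain ⟨c, hc, hM⟩ := Matrix.SpecialLinearGroup.mem_center_iff.1 hM
  have hc : (c : ℂ) ≠ 0 := by
    rintro h
    rw [Complex.ofReal_eq_zero] at h
    simp [h] at hc
  refine MonoidHom.mem_ker.2 (Equiv.ext fun z => UpperHalfPlane.ext ?_)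
  change ((M • z : UpperHalfPlane) : ℂ) = z
  simp [UpperHalfPlane.coe_specialLinearGroup_apply, ← hM, hc]

/-- The action of `PSL(2, ℝ)` on the hyperbolic plane, induced by that of `SL(2, ℝ)`. -/
instance : MulAction (PSL2 ℝ) UpperHalfPlane :=
  MulAction.compHom _ (QuotientGroup.lift _ _ center_le_ker_toPermHom)

theorem toPSL2_smul (M : SL2 ℝ) (z : UpperHalfPlane) : toPSL2 M • z = M • z := rfl

theorem continuous_smul_upperHalfPlane (z : UpperHalfPlane) :
    Continuous fun A : PSL2 ℝ => A • z :=
  QuotientGroup.isOpenQuotientMap_mk.isQuotientMap.continuous_iff.2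
    ((continuous_id.smul continuous_const : Continuous fun M : SL2 ℝ => M • z))

theorem coe_smul_upperHalfPlane (g : SL2 ℝ) (z : UpperHalfPlane) :
    ((g • z : UpperHalfPlane) : ℂ) = (g 0 0 * z + g 0 1) / (g 1 0 * z + g 1 1) :=
  UpperHalfPlane.coe_specialLinearGroup_apply g z

theorem re_smul_pos_iff (g : SL2 ℝ) (z : UpperHalfPlane) :
    0 < (g • z).re ↔ 0 < g 0 0 * g 1 0 * (z.re ^ 2 + z.im ^ 2) +
      (g 0 0 * g 1 1 + g 0 1 * g 1 0) * z.re + g 0 1 * g 1 1 := by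
  have hd : (g 1 0 * z + g 1 1 : ℂ) ≠ 0 := UpperHalfPlane.denom_ne_zero g z
  rw [← UpperHalfPlane.coe_re, coe_smul_upperHalfPlane, Complex.div_re, ← add_div,
    div_pos_iff_of_pos_right (Complex.normSq_pos.2 hd)]
  apply Eq.to_iff
  congr 1
  simp only [Fin.isValue, Complex.add_re, Complex.mul_re, Complex.ofReal_re, UpperHalfPlane.coe_re,
    Complex.ofReal_im, UpperHalfPlane.coe_im, zero_mul, sub_zero, Complex.add_im, Complex.mul_im,
    add_zero]
  ring

theorem exists_re_smul_eq_mul {g : SL2 ℝ} (hg : g 0 0 = 0) {z : UpperHalfPlane}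
    (hz : 1 < g 1 0 * z.re + g 1 1) : ∃ u ∈ Set.Ioo (0 : ℝ) 1, (g • z).re = g 0 1 * u := by
  set w : ℂ := g 1 0 * z + g 1 1
  have hre : 1 < w.re := by simpa [w] using hz
  have hsq : w.re < Complex.normSq w := by
    rw [Complex.normSq_apply]
    nlinarith [mul_self_nonneg w.im]
  have hpos : 0 < Complex.normSq w := by linarith
  refine ⟨w.re / Complex.normSq w, ⟨by positivity, (div_lt_one hpos).2 hsq⟩, ?_⟩
  rw [← UpperHalfPlane.coe_re, coe_smul_upperHalfPlane, hg]
  simp [Complex.div_re, w, mul_div_assoc]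

theorem exists_pos_add_mul_sq_pos (k : ℝ) : ∃ x > 0, 0 < x + k * x ^ 2 := by
  have hk : 0 < |k| + 1 := by positivity
  refine ⟨(|k| + 1)⁻¹, inv_pos.2 hk, ?_⟩
  have : (|k| + 1)⁻¹ + k * (|k| + 1)⁻¹ ^ 2 = (|k| + k + 1) * (|k| + 1)⁻¹ ^ 2 := by
    field_simp
    ring
  rw [this]
  exact mul_pos (by linarith [neg_abs_le k]) (by positivity)

section PreciselyInvariant

variable {g : SL2 ℝ} (h : ∀ z : UpperHalfPlane, 0 < z.re → ¬0 < (g • z).re)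

include h

theorem smul_zero_mul_smul_one_nonpos {f : Fin 2 → ℝ} (hf : 0 < f 0 * f 1) :
    (g • f) 0 * (g • f) 1 ≤ 0 := by
  have hf1 : f 1 ≠ 0 := right_ne_zero_of_mul hf.ne'
  set x := f 0 / f 1 with hx
  have hf0 : f 0 = x * f 1 := (div_mul_cancel₀ _ hf1).symm
  have hx0 : 0 < x := pos_of_mul_pos_left (by rwa [hf0, mul_assoc] at hf) (mul_self_nonneg _)
  set p : ℝ → ℝ := fun t =>
    g 0 0 * g 1 0 * (x ^ 2 + t ^ 2) + (g 0 0 * g 1 1 + g 0 1 * g 1 0) * x + g 0 1 * g 1 1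
  have hp : ∀ t ∈ Set.Ioi (0 : ℝ), p t ≤ 0 := fun t ht =>
    not_lt.1 fun hpos => h ⟨⟨x, t⟩, ht⟩ hx0 ((re_smul_pos_iff _ _).2 hpos)
  have hp0 : p 0 ≤ 0 :=
    le_of_tendsto (((by fun_prop : Continuous p).tendsto 0).mono_left nhdsWithin_le_nhds)
      (eventually_nhdsWithin_of_forall hp)
  calc (g • f) 0 * (g • f) 1 = f 1 ^ 2 * p 0 := by
        simp only [SL2.smul_apply, hf0, p]
        ring
    _ ≤ 0 := mul_nonpos_of_nonneg_of_nonpos (sq_nonneg _) hp0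

theorem mul_neg_of_smul_eq_smul {f : Fin 2 → ℝ} (hf : f ≠ 0) {c : ℝ} (hc : c ≠ 0)
    (hgf : g • f = c • f) : f 0 * f 1 < 0 := by
  have hdet := g.det_eq_one
  have h0 : g 0 0 * f 0 + g 0 1 * f 1 = c * f 0 := by
    simpa [SL2.smul_apply] using congrFun hgf 0
  have h1 : g 1 0 * f 0 + g 1 1 * f 1 = c * f 1 := by
    simpa [SL2.smul_apply] using congrFun hgf 1
  by_contra! hnonneg
  rcases hnonneg.eq_or_lt with hzero | hpos
  · rcases mul_eq_zero.1 hzero.symm with hf0 | hf1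
    · have hf1 : f 1 ≠ 0 := fun hf1 => hf (by ext i; fin_cases i <;> assumption)
      obtain ⟨x, hx, hx'⟩ := exists_pos_add_mul_sq_pos (g 0 0 * g 1 0)
      have hb : g 0 1 = 0 := by simpa [hf0, hf1] using h0
      have := smul_zero_mul_smul_one_nonpos h (f := ![x, 1]) (by simpa using hx)
      simp only [SL2.smul_apply, Matrix.cons_val_zero, Matrix.cons_val_one, hb] at this hdet
      nlinarith
    · have hf0 : f 0 ≠ 0 := fun hf0 => hf (by ext i; fin_cases i <;> assumption)
      obtain ⟨x, hx, hx'⟩ := exists_pos_add_mul_sq_pos (g 0 1 * g 1 1)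
      have hb : g 1 0 = 0 := by simpa [hf1, hf0] using h1
      have := smul_zero_mul_smul_one_nonpos h (f := ![1, x]) (by simpa using hx)
      simp only [SL2.smul_apply, Matrix.cons_val_zero, Matrix.cons_val_one, hb] at this hdet
      nlinarith
  · have := smul_zero_mul_smul_one_nonpos h hpos
    rw [hgf, Pi.smul_apply, Pi.smul_apply, smul_eq_mul, smul_eq_mul] at this
    nlinarith [mul_pos (sq_pos_of_ne_zero hc) hpos]

end PreciselyInvariant

/-! ### Ping-pong -/

section Words

variable {G : Type*} [Group G] {r s : G}

/-- Alternating products of nontrivial powers of `s` and of `r` that begin and end with a power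
of `s`. -/
inductive AltWord (r s : G) : G → Prop
  | zpow {k : ℤ} : k ≠ 0 → AltWord r s (s ^ k)
  | zpow_mul {k l : ℤ} {w : G} : k ≠ 0 → l ≠ 0 → AltWord r s w → AltWord r s (s ^ k * (r ^ l * w))

/-- Elements of the form `rᵃ` or `rᵃ w rᵇ` with `w` an alternating word; in a group generated by
`r` and `s` these are all elements. -/
def HasAltForm (r s y : G) : Prop :=
  y ∈ Subgroup.zpowers r ∨ ∃ (a b : ℤ) (w : G), AltWord r s w ∧ y = r ^ a * w * r ^ b

theorem HasAltForm.left_zpow_mul {y : G} (hy : HasAltForm r s y) (e : ℤ) :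
    HasAltForm r s (r ^ e * y) := by
  rcases hy with hy | ⟨a, b, w, hw, rfl⟩
  · exact .inl (mul_mem (zpow_mem (Subgroup.mem_zpowers r) e) hy)
  · exact .inr ⟨e + a, b, w, hw, by simp only [zpow_add, mul_assoc]⟩

theorem AltWord.hasAltForm_zpow_mul {w : G} (hw : AltWord r s w) (e b : ℤ) :
    HasAltForm r s (s ^ e * (w * r ^ b)) := by
  rcases hw with @⟨k, hk⟩ | @⟨k, l, w, hk, hl, hw⟩
  · by_cases hek : e + k = 0
    · exact .inl ⟨b, by simp only [← mul_assoc, ← zpow_add, hek, zpow_zero, one_mul]⟩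
    · exact .inr ⟨0, b, _, .zpow hek, by simp only [zpow_add, zpow_zero, one_mul, mul_assoc]⟩
  · by_cases hek : e + k = 0
    · exact .inr ⟨l, b, w, hw, by simp only [← mul_assoc, ← zpow_add, hek, zpow_zero, one_mul]⟩
    · exact .inr ⟨0, b, _, .zpow_mul hek hl hw,
        by simp only [zpow_add, zpow_zero, one_mul, mul_assoc]⟩

theorem HasAltForm.right_zpow_mul {y : G} (hy : HasAltForm r s y) {e : ℤ} (he : e ≠ 0) :
    HasAltForm r s (s ^ e * y) := by
  rcases hy with ⟨b, rfl⟩ | ⟨a, b, w, hw, rfl⟩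
  · exact .inr ⟨0, b, _, .zpow he, by simp only [zpow_zero, one_mul]⟩
  · by_cases ha : a = 0
    · simpa only [ha, zpow_zero, one_mul] using hw.hasAltForm_zpow_mul e b
    · exact .inr ⟨0, b, _, .zpow_mul he ha hw, by simp only [zpow_zero, one_mul, mul_assoc]⟩

theorem hasAltForm_of_closure_eq_top (h : Subgroup.closure {r, s} = ⊤) (y : G) :
    HasAltForm r s y := by
  have hy : y ∈ Subgroup.closure {r, s} := h ▸ Subgroup.mem_top y
  induction hy using Subgroup.closure_induction_left with
  | one => exact .inl (one_mem _)
  | mul_left x hx y _ ih =>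
    rcases hx with rfl | rfl
    · simpa using ih.left_zpow_mul 1
    · simpa using ih.right_zpow_mul one_ne_zero
  | inv_mul_cancel x hx y _ ih =>
    rcases hx with rfl | rfl
    · simpa using ih.left_zpow_mul (-1)
    · simpa using ih.right_zpow_mul (e := -1) (by norm_num)

end Words

section PingPong

variable {G H X : Type*} [Group G] [Group H] [MulAction H X]

theorem zpow_smul_mem_of_compl_subset {g : H} {W A : Set X}
    (hg : ∀ z ∈ W, g • z ∈ W ∧ g • z ∈ A) (hW : Aᶜ ⊆ W) {k : ℤ} (hk : k ≠ 0) :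
    ∀ z ∈ Aᶜ, g ^ k • z ∈ A := by
  have hpow (n : ℕ) : ∀ z ∈ W, g ^ (n + 1) • z ∈ W ∧ g ^ (n + 1) • z ∈ A := by
    induction n with
    | zero => simpa using hg
    | succ n ih =>
      intro z hz
      rw [pow_succ', mul_smul]
      exact hg _ (ih z hz).1
  intro z hz
  obtain ⟨n, rfl | rfl⟩ : ∃ n : ℕ, k = (n + 1 : ℕ) ∨ k = -(n + 1 : ℕ) :=
    ⟨k.natAbs - 1, by omega⟩
  · rw [zpow_natCast]
    exact (hpow n z (hW hz)).2
  · by_contra hA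
    refine hz ?_
    have := (hpow n _ (hW hA)).2
    rwa [← zpow_natCast, zpow_neg, smul_inv_smul] at this

/-- The ping-pong configuration: `r` and `s` generate `G`, and under `φ` the nontrivial powers of
`r` map the complement of `A` into `A`, those of `s` map the complement of `B` into `B`, where `A`
and `B` are disjoint. -/
structure IsPingPong (φ : G →* H) (r s : G) (A B : Set X) : Prop where
  closure_eq_top : Subgroup.closure {r, s} = ⊤
  disjoint : Disjoint A B
  left {k : ℤ} (hk : k ≠ 0) : ∀ z ∈ Aᶜ, φ r ^ k • z ∈ A
  right {k : ℤ} (hk : k ≠ 0) : ∀ z ∈ Bᶜ, φ s ^ k • z ∈ B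

namespace IsPingPong

variable {φ : G →* H} {r s : G} {A B : Set X} (h : IsPingPong φ r s A B)

include h

theorem altWord_smul_mem {w : G} (hw : AltWord r s w) : ∀ z ∈ A, φ w • z ∈ B := by
  have hAB : A ⊆ Bᶜ := h.disjoint.subset_compl_right
  have hBA : B ⊆ Aᶜ := h.disjoint.symm.subset_compl_right
  induction hw with
  | zpow hk =>
    intro z hz
    rw [map_zpow]
    exact h.right hk z (hAB hz)
  | zpow_mul hk hl _ ih =>
    intro z hz
    rw [map_mul, map_mul, map_zpow, map_zpow, mul_smul, mul_smul]
    exact h.right hk _ (hAB (h.left hl _ (hBA (ih z hz))))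

theorem zpow_mul_altWord_mul_zpow_smul_mem {a b : ℤ} (ha : a ≠ 0) (hb : b ≠ 0) {w : G}
    (hw : AltWord r s w) : ∀ z ∈ Aᶜ, φ (r ^ a * w * r ^ b) • z ∈ A := by
  intro z hz
  rw [map_mul, map_mul, map_zpow, map_zpow, mul_smul, mul_smul]
  exact h.left ha _
    (h.disjoint.symm.subset_compl_right (h.altWord_smul_mem hw _ (h.left hb z hz)))

theorem exists_conj_smul_mem {g : G} (hg : g ≠ 1) :
    ∃ j : Fin 3, ∀ z ∈ Aᶜ, φ (r ^ (j : ℕ) * g * (r ^ (j : ℕ))⁻¹) • z ∈ A := by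
  rcases hasAltForm_of_closure_eq_top h.closure_eq_top g with ⟨a, rfl⟩ | ⟨a, b, w, hw, rfl⟩
  · have ha : a ≠ 0 := by
      rintro rfl
      exact hg (zpow_zero r)
    exact ⟨0, by simpa using h.left ha⟩
  · obtain ⟨j, ha, hb⟩ : ∃ j : Fin 3, ((j : ℕ) : ℤ) + a ≠ 0 ∧ b - ((j : ℕ) : ℤ) ≠ 0 := by
      obtain ⟨n, hn, h⟩ : ∃ n : ℕ, n < 3 ∧ (n : ℤ) + a ≠ 0 ∧ b - (n : ℤ) ≠ 0 := by
        by_contra! h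
        have h0 := h 0 (by norm_num)
        have h1 := h 1 (by norm_num)
        have h2 := h 2 (by norm_num)
        omega
      exact ⟨⟨n, hn⟩, h⟩
    refine ⟨j, ?_⟩
    have hconj : r ^ (j : ℕ) * (r ^ a * w * r ^ b) * (r ^ (j : ℕ))⁻¹ =
        r ^ (((j : ℕ) : ℤ) + a) * w * r ^ (b - ((j : ℕ) : ℤ)) := by
      simp only [zpow_add, zpow_sub, zpow_natCast, mul_assoc]
    rw [hconj]
    exact h.zpow_mul_altWord_mul_zpow_smul_mem ha hb hw

open scoped Pointwise in
theorem smul_notMem_of_notMem_zpowers {V : Set X} (hVA : V ⊆ A)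
    (hV : φ r ∈ MulAction.stabilizer H V) {y : G} (hy : y ∉ Subgroup.zpowers r) :
    ∀ z ∈ V, φ y • z ∉ V := by
  have hzpow (k : ℤ) (z : X) : φ (r ^ k) • z ∈ V ↔ z ∈ V := by
    rw [map_zpow]
    exact MulAction.mem_stabilizer_set.1 (zpow_mem hV k) z
  obtain ⟨a, b, w, hw, rfl⟩ := (hasAltForm_of_closure_eq_top h.closure_eq_top y).resolve_left hy
  intro z hz hyz
  rw [map_mul, map_mul, mul_smul, mul_smul, hzpow] at hyz
  exact h.disjoint.notMem_of_mem_left (hVA hyz)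
    (h.altWord_smul_mem hw _ (hVA ((hzpow b z).2 hz)))

end IsPingPong

theorem injective_and_discreteTopology_range [TopologicalSpace H] [IsTopologicalGroup H]
    [TopologicalSpace X] {ι : Type*} [Finite ι] {φ : G →* H} (c : ι → G) {U : Set X}
    (hU : IsOpen U) {z : X} (hz : z ∈ U) (hcont : Continuous fun A : H => A • z)
    (hφ : ∀ g ≠ 1, ∃ j, φ (c j * g * (c j)⁻¹) • z ∉ U) :
    Function.Injective φ ∧ DiscreteTopology φ.range := by
  set V : Set H := ⋂ j, {A | (φ (c j) * A * (φ (c j))⁻¹) • z ∈ U}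
  have hV : IsOpen V :=
    isOpen_iInter_of_finite fun j => (hU.preimage hcont).preimage (by fun_prop)
  have hone : (1 : H) ∈ V := Set.mem_iInter.2 fun j => by simpa using hz
  have hnotMem {g : G} (hg : φ g ∈ V) : g = 1 := by
    by_contra hg1
    obtain ⟨j, hj⟩ := hφ g hg1
    rw [map_mul, map_mul, map_inv] at hj
    exact hj (Set.mem_iInter.1 hg j)
  refine ⟨(injective_iff_map_eq_one φ).2 fun g hg => hnotMem (hg ▸ hone),
    discreteTopology_of_isOpen_singleton_one ?_⟩
  convert hV.preimage continuous_subtype_val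
  ext ⟨_, g, rfl⟩
  refine ⟨fun hg => ?_, fun hg => Subtype.ext ?_⟩
  · rwa [Set.mem_preimage, congrArg Subtype.val hg]
  · rw [hnotMem hg]
    exact map_one φ

end PingPong

/-! ### The pants group -/

theorem bdry_two_eq : bdry 2 = (bdry 1 * bdry 0)⁻¹ := by
  have h : PresentedGroup.mk pantsRels (FreeGroup.of 2 * FreeGroup.of 1 * FreeGroup.of 0) = 1 :=
    PresentedGroup.one_of_mem (Set.mem_singleton _)
  rw [map_mul, map_mul, mul_assoc] at h
  exact eq_inv_of_mul_eq_one_left h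

theorem closure_bdry : Subgroup.closure {bdry 0, bdry 1} = ⊤ := by
  have h0 : bdry 0 ∈ Subgroup.closure {bdry 0, bdry 1} := Subgroup.subset_closure (by simp)
  have h1 : bdry 1 ∈ Subgroup.closure {bdry 0, bdry 1} := Subgroup.subset_closure (by simp)
  rw [eq_top_iff, ← PresentedGroup.closure_range_of, Subgroup.closure_le]
  rintro _ ⟨i, rfl⟩
  change bdry i ∈ Subgroup.closure {bdry 0, bdry 1}
  match i with
  | 0 => exact h0
  | 1 => exact h1
  | 2 => exact bdry_two_eq ▸ inv_mem (mul_mem h1 h0)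

section pantsHom

variable {G : Type*} [Group G]

theorem pantsGroup_hom_ext {φ ψ : PantsGroup →* G} (h0 : φ (bdry 0) = ψ (bdry 0))
    (h1 : φ (bdry 1) = ψ (bdry 1)) : φ = ψ :=
  MonoidHom.eq_of_eqOn_dense closure_bdry (by rintro _ (rfl | rfl) <;> assumption)

/-- The homomorphism from the pants group, which is free on `r` and `s`, with prescribed values
at `r` and `s`. -/
def pantsHom (a b : G) : PantsGroup →* G :=
  PresentedGroup.toGroup (f := ![a, b, (b * a)⁻¹]) (by simp [pantsRels, mul_assoc])

theorem pantsHom_bdry (a b : G) (i : Fin 3) : pantsHom a b (bdry i) = ![a, b, (b * a)⁻¹] i :=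
  PresentedGroup.toGroup.of _

theorem continuous_pantsGroup_hom_apply {X : Type*} [TopologicalSpace X] [TopologicalSpace G]
    [IsTopologicalGroup G] {φ : X → PantsGroup →* G} (h0 : Continuous fun a => φ a (bdry 0))
    (h1 : Continuous fun a => φ a (bdry 1)) (y : PantsGroup) : Continuous fun a => φ a y := by
  have hy : y ∈ Subgroup.closure {bdry 0, bdry 1} := closure_bdry ▸ Subgroup.mem_top y
  induction hy using Subgroup.closure_induction with
  | mem y hy => rcases hy with rfl | rfl <;> assumption
  | one => simpa only [map_one] using continuous_const
  | mul y z _ _ hy hz =>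
    simp only [map_mul]
    exact hy.mul hz
  | inv y _ hy =>
    simp only [map_inv]
    exact hy.inv

end pantsHom

/-- The automorphism `r ↦ s ↦ t ↦ r`. -/
def rotate : PantsGroup →* PantsGroup := pantsHom (bdry 1) (bdry 2)

theorem rotate_bdry (i : Fin 3) : rotate (bdry i) = bdry (i + 1) := by
  rw [rotate, pantsHom_bdry]
  match i with
  | 0 => rfl
  | 1 => rfl
  | 2 =>
    change (bdry 2 * bdry 1)⁻¹ = bdry 0
    rw [bdry_two_eq]
    group

theorem rotate_surjective : Function.Surjective rotate := by
  rw [← MonoidHom.range_eq_top, eq_top_iff, ← closure_bdry, Subgroup.closure_le]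
  rintro _ (rfl | rfl)
  · exact ⟨bdry 2, rotate_bdry 2⟩
  · exact ⟨bdry 0, rotate_bdry 0⟩

theorem not_commute_bdry {i j : Fin 3} (h : i ≠ j) : ¬Commute (bdry i) (bdry j) := by
  intro hc
  have hperm := hc.map (pantsHom (Equiv.swap (0 : Fin 3) 1) (Equiv.swap (1 : Fin 3) 2))
  rw [pantsHom_bdry, pantsHom_bdry, commute_iff_eq] at hperm
  clear hc
  revert i j
  decide

/-! ### The normal form -/

/-- The matrix of `r` in the normal form with boundary length `l` at `r`. -/
def firstMat (l : ℝ) : SL2 ℝ :=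
  ⟨!![0, -1; 1, 2 * Real.cosh (l / 2)], by simp [Matrix.det_fin_two_of]⟩

/-- The matrix of `s` in the normal form with boundary lengths `m` at `s` and `n` at `t`. -/
def secondMat (m n : ℝ) : SL2 ℝ :=
  ⟨!![2 * Real.cosh (m / 2), -Real.exp (n / 2); Real.exp (-(n / 2)), 0], by
    simp [Matrix.det_fin_two_of, ← Real.exp_add]⟩

/-- The representation of the pants group in `PSL(2, ℝ)` with boundary lengths `L`, in the basis
`e, R e` where `R` is a lift of the image of `r` and `e` is an eigenvector of the image of `t`. -/
def normalRep (L : Fin 3 → ℝ) : PantsGroup →* PSL2 ℝ :=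
  pantsHom (toPSL2 (firstMat (L 0))) (toPSL2 (secondMat (L 1) (L 2)))

theorem normalRep_bdry_zero (L : Fin 3 → ℝ) : normalRep L (bdry 0) = toPSL2 (firstMat (L 0)) :=
  pantsHom_bdry _ _ 0

theorem normalRep_bdry_one (L : Fin 3 → ℝ) :
    normalRep L (bdry 1) = toPSL2 (secondMat (L 1) (L 2)) :=
  pantsHom_bdry _ _ 1

theorem exists_eq_conj_normalRep {ρ : PantsGroup →* PSL2 ℝ} {R S : SL2 ℝ} {L : Fin 3 → ℝ}
    {e : Fin 2 → ℝ} (hR : ρ (bdry 0) = toPSL2 R) (hS : ρ (bdry 1) = toPSL2 S)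
    (hRtr : R.1.trace = 2 * Real.cosh (L 0 / 2)) (hStr : S.1.trace = 2 * Real.cosh (L 1 / 2))
    (he : 0 < area e (R • e)) (hSRe : S • R • e = -Real.exp (L 2 / 2) • e) :
    ∃ g : PSL2 ℝ, ρ = (MulAut.conj g).toMonoidHom.comp (normalRep L) := by
  have hexp : Real.exp (-(L 2 / 2)) * Real.exp (L 2 / 2) = 1 := by
    rw [← Real.exp_add, neg_add_cancel, Real.exp_zero]
  have hRRe : R • R • e = (2 * Real.cosh (L 0 / 2)) • (R • e) - e := by
    rw [← hRtr, ← SL2.smul_add_inv_smul, inv_smul_smul, add_sub_cancel_right]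
  have hSinv : S⁻¹ • e = -(Real.exp (-(L 2 / 2)) • R • e) := by
    rw [inv_smul_eq_iff, smul_neg, smul_comm S, hSRe, smul_smul, mul_neg, hexp, neg_smul, one_smul,
      neg_neg]
  have hSe : S • e = (2 * Real.cosh (L 1 / 2)) • e + Real.exp (-(L 2 / 2)) • (R • e) := by
    rw [← hStr, ← SL2.smul_add_inv_smul, hSinv, neg_add_cancel_right]
  obtain ⟨P, -, -, -, -, hP⟩ := exists_eq_conj_of_area_pos he
  refine ⟨toPSL2 P, pantsGroup_hom_ext ?_ ?_⟩
  · rw [hR, hP R (firstMat (L 0)) (by simp [firstMat])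
      (by simp [hRRe, firstMat, sub_eq_neg_add])]
    simp [normalRep_bdry_zero]
  · rw [hS, hP S (secondMat (L 1) (L 2)) (by simp [secondMat, hSe])
      (by rw [hSRe]; simp [secondMat])]
    simp [normalRep_bdry_one]

theorem two_le_two_mul_cosh (x : ℝ) : 2 ≤ 2 * Real.cosh x := by linarith [Real.one_le_cosh x]

theorem zpow_firstMat_smul_re_neg (l : ℝ) {k : ℤ} (hk : k ≠ 0) :
    ∀ z ∈ {z : UpperHalfPlane | z.re < 0}ᶜ,
      firstMat l ^ k • z ∈ {z : UpperHalfPlane | z.re < 0} := by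
  refine zpow_smul_mem_of_compl_subset (W := {z | -1 < z.re}) (fun z hz => ?_) (fun z hz => ?_) hk
  · have hz' : 1 < firstMat l 1 0 * z.re + firstMat l 1 1 := by
      change 1 < 1 * z.re + 2 * Real.cosh (l / 2)
      linarith [show -1 < z.re from hz, two_le_two_mul_cosh (l / 2)]
    obtain ⟨u, hu, h⟩ := exists_re_smul_eq_mul rfl hz'
    have h' : (firstMat l • z).re = -u := by simpa [firstMat] using h
    rw [Set.mem_ofPred_eq, Set.mem_ofPred_eq, h']
    constructor <;> linarith [hu.1, hu.2]
  · rw [Set.mem_compl_iff, Set.mem_ofPred_eq, not_lt] at hz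
    exact neg_one_lt_zero.trans_le hz

theorem zpow_secondMat_smul_re_pos (m n : ℝ) {k : ℤ} (hk : k ≠ 0) :
    ∀ z ∈ {z : UpperHalfPlane | 0 < z.re}ᶜ,
      secondMat m n ^ k • z ∈ {z : UpperHalfPlane | 0 < z.re} := by
  have hv := Real.exp_pos (n / 2)
  have hinv : ((secondMat m n)⁻¹ : SL2 ℝ).1 =
      !![0, Real.exp (n / 2); -Real.exp (-(n / 2)), 2 * Real.cosh (m / 2)] := by
    rw [SL2.inv_eq]
    simp [secondMat]
  rw [← neg_neg k, ← inv_zpow']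
  refine zpow_smul_mem_of_compl_subset (W := {z | z.re < Real.exp (n / 2)}) (fun z hz => ?_)
    (fun z hz => ?_) (neg_ne_zero.2 hk)
  · have hz' : Real.exp (-(n / 2)) * z.re < 1 := by
      rwa [Real.exp_neg, inv_mul_lt_one₀ hv]
    have hz'' : 1 < ((secondMat m n)⁻¹ : SL2 ℝ) 1 0 * z.re + ((secondMat m n)⁻¹ : SL2 ℝ) 1 1 := by
      rw [hinv]
      change 1 < -Real.exp (-(n / 2)) * z.re + 2 * Real.cosh (m / 2)
      linarith [two_le_two_mul_cosh (m / 2)]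
    obtain ⟨u, hu, h⟩ := exists_re_smul_eq_mul (g := (secondMat m n)⁻¹) (z := z) (by simp [hinv])
      hz''
    have h' : ((secondMat m n)⁻¹ • z).re = Real.exp (n / 2) * u := by simpa [hinv] using h
    rw [Set.mem_ofPred_eq, Set.mem_ofPred_eq, h']
    exact ⟨mul_lt_of_lt_one_right hv hu.2, mul_pos hv hu.1⟩
  · rw [Set.mem_compl_iff, Set.mem_ofPred_eq, not_lt] at hz
    exact hz.trans_lt hv

theorem isPingPong_normalRep (L : Fin 3 → ℝ) :
    IsPingPong (normalRep L) (bdry 0) (bdry 1) {z : UpperHalfPlane | z.re < 0}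
      {z : UpperHalfPlane | 0 < z.re} where
  closure_eq_top := closure_bdry
  disjoint := Set.disjoint_left.2 fun z (hz : z.re < 0) => (not_lt_of_gt hz :)
  left hk z hz := by
    rw [normalRep_bdry_zero]
    exact zpow_firstMat_smul_re_neg (L 0) hk z hz
  right hk z hz := by
    rw [normalRep_bdry_one]
    exact zpow_secondMat_smul_re_pos (L 1) (L 2) hk z hz

theorem normalRep_injective_and_discrete (L : Fin 3 → ℝ) :
    Function.Injective (normalRep L) ∧ DiscreteTopology (normalRep L).range := by
  have h := isPingPong_normalRep L
  have hz : (⟨⟨1, 1⟩, one_pos⟩ : UpperHalfPlane) ∈ {z : UpperHalfPlane | 0 < z.re} :=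
    zero_lt_one' ℝ
  refine injective_and_discreteTopology_range (fun j : Fin 3 => bdry 0 ^ (j : ℕ))
    (isOpen_lt continuous_const UpperHalfPlane.continuous_re) hz
    (continuous_smul_upperHalfPlane _) fun g hg => ?_
  obtain ⟨j, hj⟩ := h.exists_conj_smul_mem hg
  exact ⟨j, h.disjoint.notMem_of_mem_left (hj _ (h.disjoint.notMem_of_mem_right hz))⟩

section SurfaceOnLeft

variable {G H : Type} [Group G] [Group H]

theorem SurfaceOnLeft.conj {ρ : G →* PSL2 ℝ} {x : G} (h : SurfaceOnLeft ρ x) (g : PSL2 ℝ) :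
    SurfaceOnLeft ((MulAut.conj g).toMonoidHom.comp ρ) x := by
  obtain ⟨Q, rfl⟩ := QuotientGroup.mk_surjective g
  rcases h with ⟨P, l, hl, hx, hU⟩ | ⟨P, hx⟩
  · refine .inl ⟨Q * P, l, hl, ?_, fun y hy M hM z hz hz' => ?_⟩
    · change toPSL2 Q * ρ x * (toPSL2 Q)⁻¹ = _
      rw [hx]
      change toPSL2 (Q * (P * hypMat l * P⁻¹) * Q⁻¹) = _
      congr 1
      group
    · refine hU y hy (Q⁻¹ * M * Q) ?_ (Q⁻¹ • z) ?_ ?_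
      · change (toPSL2 Q)⁻¹ * toPSL2 M * toPSL2 Q = _
        rw [hM]
        change (toPSL2 Q)⁻¹ * (toPSL2 Q * ρ y * (toPSL2 Q)⁻¹) * toPSL2 Q = _
        group
      · rwa [mul_inv_rev, mul_smul] at hz
      · rw [mul_inv_rev, mul_smul] at hz'
        rwa [mul_smul, mul_smul, smul_inv_smul]
  · refine .inr ⟨Q * P, ?_⟩
    change toPSL2 Q * ρ x * (toPSL2 Q)⁻¹ = _
    rw [hx]
    change toPSL2 (Q * (P * parMat * P⁻¹) * Q⁻¹) = _
    congr 1
    group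

theorem SurfaceOnLeft.of_comp {ρ : H →* PSL2 ℝ} {f : G →* H} (hf : Function.Surjective f) {x : G}
    (h : SurfaceOnLeft (ρ.comp f) x) : SurfaceOnLeft ρ (f x) := by
  rcases h with ⟨P, l, hl, hx, hU⟩ | h
  · refine .inl ⟨P, l, hl, hx, fun y hy M hM z => ?_⟩
    obtain ⟨y, rfl⟩ := hf y
    refine hU y (fun hy' => hy ?_) M hM z
    obtain ⟨k, rfl⟩ := hy'
    exact ⟨k, (map_zpow f x k).symm⟩
  · exact .inr h

end SurfaceOnLeft

theorem firstMat_smul (l : ℝ) (e : Fin 2 → ℝ) :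
    firstMat l • e = ![-e 1, e 0 + 2 * Real.cosh (l / 2) * e 1] := by
  ext i
  rw [SL2.smul_apply]
  fin_cases i <;> simp [firstMat]

theorem secondMat_smul (m n : ℝ) (e : Fin 2 → ℝ) :
    secondMat m n • e =
      ![2 * Real.cosh (m / 2) * e 0 - Real.exp (n / 2) * e 1, Real.exp (-(n / 2)) * e 0] := by
  ext i
  rw [SL2.smul_apply]
  fin_cases i <;> simp [secondMat, sub_eq_add_neg]

theorem two_mul_cosh_half (l : ℝ) :
    2 * Real.cosh (l / 2) = Real.exp (l / 2) + (Real.exp (l / 2))⁻¹ := by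
  rw [Real.cosh_eq, Real.exp_neg]
  ring

theorem firstMat_smul_eigenvector (l : ℝ) :
    firstMat l • ![-Real.exp (l / 2), 1] = (Real.exp (l / 2))⁻¹ • ![-Real.exp (l / 2), 1] := by
  rw [firstMat_smul, two_mul_cosh_half]
  ext i
  fin_cases i <;> simp

theorem firstMat_zero_eq_conj_parMat : ∃ P : SL2 ℝ, firstMat 0 = P * parMat * P⁻¹ := by
  obtain ⟨P, -, -, -, -, hP⟩ := exists_eq_conj_of_area_pos (e := ![1, -1]) (f := ![0, 1])
    (by simp [area])
  refine ⟨P, hP _ _ ?_ ?_⟩ <;> rw [firstMat_smul] <;> ext i <;> fin_cases i <;> norm_num [parMat]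

theorem firstMat_eq_conj_hypMat {l : ℝ} (hl : 0 < l) : ∃ P : SL2 ℝ,
    firstMat l = P * hypMat l * P⁻¹ ∧ ∀ z : UpperHalfPlane, 0 < (P⁻¹ • z).re → z.re < 0 := by
  set E := Real.exp (l / 2) with hE
  have hE1 : 1 < E := Real.one_lt_exp_iff.2 (half_pos hl)
  obtain ⟨P, k, hk, hPe, hPf, hP⟩ := exists_eq_conj_of_area_pos (e := ![-1, E]) (f := ![-E, 1])
    (by simp only [area, Matrix.cons_val_zero, Matrix.cons_val_one]; nlinarith)
  refine ⟨P, hP _ _ ?_ ?_, fun z hz => ?_⟩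
  · rw [firstMat_smul, two_mul_cosh_half, ← hE]
    ext i
    fin_cases i <;> simp [hypMat, ← hE, add_mul, (one_pos.trans hE1).ne']
  · rw [firstMat_smul_eigenvector]
    simp [hypMat, Real.exp_neg, ← hE]
  · by_contra! hre
    have hinv : (P⁻¹).1 = !![k, k * E; -(k * E), -k] := by
      rw [SL2.inv_eq]
      simp [hPe, hPf]
    rw [re_smul_pos_iff, hinv] at hz
    simp only [Matrix.of_apply, Matrix.cons_val', Matrix.cons_val_zero, Matrix.cons_val_one,
      Matrix.cons_val_fin_one] at hz
    have h0 : 0 ≤ k ^ 2 * (E * (z.re ^ 2 + z.im ^ 2) + (1 + E ^ 2) * z.re + E) := by positivity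
    linarith

theorem re_hypMat_smul_pos_iff (l : ℝ) (z : UpperHalfPlane) :
    0 < (hypMat l • z).re ↔ 0 < z.re := by
  rw [re_smul_pos_iff]
  simp [hypMat, ← Real.exp_add]

open scoped Pointwise in
theorem surfaceOnLeft_normalRep_bdry_zero {L : Fin 3 → ℝ} (h0 : 0 ≤ L 0) :
    SurfaceOnLeft (normalRep L) (bdry 0) := by
  rcases h0.eq_or_lt with h0 | h0
  · obtain ⟨P, hP⟩ := firstMat_zero_eq_conj_parMat
    exact .inr ⟨P, by rw [normalRep_bdry_zero, ← h0, hP]⟩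
  · obtain ⟨P, hP, hre⟩ := firstMat_eq_conj_hypMat h0
    refine .inl ⟨P, L 0, h0, by rw [normalRep_bdry_zero, hP], fun y hy M hM z hz hMz => ?_⟩
    set V : Set UpperHalfPlane := {z | 0 < (P⁻¹ • z).re}
    have hV : normalRep L (bdry 0) ∈ MulAction.stabilizer (PSL2 ℝ) V := by
      refine MulAction.mem_stabilizer_set.2 fun z => ?_
      change 0 < (P⁻¹ • (normalRep L (bdry 0) • z)).re ↔ 0 < (P⁻¹ • z).re
      rw [normalRep_bdry_zero, toPSL2_smul, hP, mul_smul, mul_smul, inv_smul_smul,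
        re_hypMat_smul_pos_iff]
    refine (isPingPong_normalRep L).smul_notMem_of_notMem_zpowers hre hV hy z hz ?_
    rwa [← hM, toPSL2_smul]

theorem normalRep_comp_rotate (L : Fin 3 → ℝ) : ∃ g : PSL2 ℝ,
    (normalRep L).comp rotate =
      (MulAut.conj g).toMonoidHom.comp (normalRep fun i => L (i + 1)) := by
  set R := firstMat (L 0) with hR
  set S := secondMat (L 1) (L 2) with hS
  have hE := Real.exp_pos (L 0 / 2)
  refine exists_eq_conj_normalRep (R := S) (S := -(S * R)⁻¹) (e := ![-Real.exp (L 0 / 2), 1])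
    ?_ ?_ ?_ ?_ ?_ ?_
  · rw [MonoidHom.comp_apply, rotate_bdry]
    exact normalRep_bdry_one L
  · rw [MonoidHom.comp_apply, rotate_bdry, toPSL2_neg]
    change normalRep L (bdry 2) = _
    rw [bdry_two_eq, map_inv, map_mul, normalRep_bdry_zero, normalRep_bdry_one]
    rfl
  · simp [hS, secondMat, Matrix.trace_fin_two]
  · change _ = 2 * Real.cosh (L 2 / 2)
    rw [Matrix.SpecialLinearGroup.coe_neg, Matrix.trace_neg, SL2.trace_inv,
      Matrix.SpecialLinearGroup.coe_mul, Matrix.trace_fin_two, two_mul_cosh_half]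
    simp [hR, hS, firstMat, secondMat, Matrix.mul_apply, Fin.sum_univ_two, Real.exp_neg, add_comm]
  · simp only [hS, area, secondMat_smul, Matrix.cons_val_zero, Matrix.cons_val_one]
    have h0 : 0 < Real.exp (L 0 / 2) * (Real.exp (-(L 2 / 2)) * Real.exp (L 0 / 2)) +
        2 * Real.cosh (L 1 / 2) * Real.exp (L 0 / 2) + Real.exp (L 2 / 2) := by positivity
    linarith
  · change _ = -Real.exp (L 0 / 2) • _
    rw [SL2.neg_smul, mul_inv_rev, mul_smul, inv_smul_smul, neg_smul, neg_inj, inv_smul_eq_iff,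
      smul_comm R, firstMat_smul_eigenvector, smul_inv_smul₀ hE.ne']

theorem forall_fin_three_of_rotate {P : (Fin 3 → ℝ) → Fin 3 → Prop} (h0 : ∀ L, P L 0)
    (h : ∀ L i, P (fun j => L (j + 1)) i → P L (i + 1)) (L : Fin 3 → ℝ) (i : Fin 3) : P L i := by
  match i with
  | 0 => exact h0 L
  | 1 => exact h L 0 (h0 _)
  | 2 => exact h L 1 (h _ 0 (h0 _))

theorem hypLength_conj (g A : PSL2 ℝ) : hypLength (g * A * g⁻¹) = hypLength A := by
  obtain ⟨P, rfl⟩ := QuotientGroup.mk_surjective g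
  obtain ⟨M, rfl⟩ := QuotientGroup.mk_surjective A
  change 2 * Real.arcosh (|(P * M * P⁻¹).1.trace| / 2) = 2 * Real.arcosh (|M.1.trace| / 2)
  rw [SL2.trace_conj]

theorem hypLength_toPSL2_of_trace_eq {M : SL2 ℝ} {l : ℝ} (hl : 0 ≤ l)
    (h : M.1.trace = 2 * Real.cosh (l / 2)) : hypLength (toPSL2 M) = l := by
  change 2 * Real.arcosh (|M.1.trace| / 2) = l
  rw [h, abs_of_pos (by positivity), mul_div_cancel_left₀ _ two_ne_zero,
    Real.arcosh_cosh (by positivity), mul_div_cancel₀ _ two_ne_zero]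

theorem surfaceOnLeft_normalRep {L : Fin 3 → ℝ} (hL : ∀ i, 0 ≤ L i) (i : Fin 3) :
    SurfaceOnLeft (normalRep L) (bdry i) := by
  refine forall_fin_three_of_rotate
    (P := fun L i => (∀ i, 0 ≤ L i) → SurfaceOnLeft (normalRep L) (bdry i))
    (fun L hL => surfaceOnLeft_normalRep_bdry_zero (hL 0)) (fun L i ih hL => ?_) L i hL
  obtain ⟨g, hg⟩ := normalRep_comp_rotate L
  rw [← rotate_bdry]
  exact .of_comp rotate_surjective (hg ▸ (ih fun j => hL (j + 1)).conj g)

theorem hypLength_normalRep_bdry {L : Fin 3 → ℝ} (hL : ∀ i, 0 ≤ L i) (i : Fin 3) :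
    hypLength (normalRep L (bdry i)) = L i := by
  refine forall_fin_three_of_rotate
    (P := fun L i => (∀ i, 0 ≤ L i) → hypLength (normalRep L (bdry i)) = L i)
    (fun L hL => ?_) (fun L i ih hL => ?_) L i hL
  · rw [normalRep_bdry_zero]
    exact hypLength_toPSL2_of_trace_eq (hL 0) (by simp [firstMat, Matrix.trace_fin_two])
  · obtain ⟨g, hg⟩ := normalRep_comp_rotate L
    rw [← rotate_bdry, ← MonoidHom.comp_apply, hg]
    exact (hypLength_conj g _).trans (ih fun j => hL (j + 1))

theorem isPantsHolonomy_normalRep {L : Fin 3 → ℝ} (hL : ∀ i, 0 ≤ L i) :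
    IsPantsHolonomy (normalRep L) where
  faithful := (normalRep_injective_and_discrete L).1
  discrete := (normalRep_injective_and_discrete L).2
  left := surfaceOnLeft_normalRep hL

/-! ### Uniqueness of the holonomy with given boundary lengths -/

theorem hypMat_smul (l : ℝ) (e : Fin 2 → ℝ) :
    hypMat l • e = ![Real.exp (l / 2) * e 0, Real.exp (-(l / 2)) * e 1] := by
  ext i
  rw [SL2.smul_apply]
  fin_cases i <;> simp [hypMat]

theorem parMat_smul (e : Fin 2 → ℝ) : parMat • e = ![e 0 - e 1, e 1] := by
  ext i
  rw [SL2.smul_apply]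
  fin_cases i <;> simp [parMat, sub_eq_add_neg]

theorem area_hypMat_smul (l : ℝ) (e : Fin 2 → ℝ) :
    area e (hypMat l • e) = (Real.exp (-(l / 2)) - Real.exp (l / 2)) * (e 0 * e 1) := by
  simp only [hypMat_smul, area, Matrix.cons_val_zero, Matrix.cons_val_one]
  ring

theorem area_parMat_smul (e : Fin 2 → ℝ) : area e (parMat • e) = e 1 ^ 2 := by
  simp only [parMat_smul, area, Matrix.cons_val_zero, Matrix.cons_val_one]
  ring

theorem trace_conj_hypMat (P : SL2 ℝ) (l : ℝ) :
    (P * hypMat l * P⁻¹).1.trace = 2 * Real.cosh (l / 2) := by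
  rw [SL2.trace_conj, two_mul_cosh_half, ← Real.exp_neg]
  exact Matrix.trace_fin_two _

theorem trace_conj_parMat (P : SL2 ℝ) : (P * parMat * P⁻¹).1.trace = 2 := by
  rw [SL2.trace_conj, Matrix.trace_fin_two]
  norm_num [parMat]

theorem eq_of_toPSL2_eq_of_trace_pos {M N : SL2 ℝ} (h : toPSL2 M = toPSL2 N)
    (hM : 0 < M.1.trace) (hN : 0 < N.1.trace) : M = N := by
  rcases toPSL2_eq_iff.1 h with rfl | rfl
  · rfl
  · rw [Matrix.SpecialLinearGroup.coe_neg, Matrix.trace_neg] at hN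
    linarith

theorem hypLength_conj_hypMat (P : SL2 ℝ) {l : ℝ} (hl : 0 ≤ l) :
    hypLength (toPSL2 (P * hypMat l * P⁻¹)) = l :=
  hypLength_toPSL2_of_trace_eq hl (trace_conj_hypMat P l)

theorem hypLength_conj_parMat (P : SL2 ℝ) : hypLength (toPSL2 (P * parMat * P⁻¹)) = 0 :=
  hypLength_toPSL2_of_trace_eq le_rfl (by rw [trace_conj_parMat]; simp)

theorem inv_smul_mul_inv_smul_neg {P M : SL2 ℝ}
    (h : ∀ z : UpperHalfPlane, 0 < (P⁻¹ • z).re → ¬0 < (P⁻¹ • (M • z)).re) {e : Fin 2 → ℝ}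
    (he : e ≠ 0) {c : ℝ} (hc : c ≠ 0) (hMe : M • e = c • e) :
    (P⁻¹ • e) 0 * (P⁻¹ • e) 1 < 0 := by
  refine mul_neg_of_smul_eq_smul (g := P⁻¹ * M * P) (fun z hz => ?_)
    ((smul_ne_zero_iff_ne _).2 he) hc ?_
  · rw [mul_smul, mul_smul]
    exact h (P • z) (by rwa [inv_smul_smul])
  · rw [mul_smul, mul_smul, smul_inv_smul, hMe, smul_comm]

theorem commute_parMat_of_smul_eq {Y : SL2 ℝ} (h : Y • ![1, 0] = ![(1 : ℝ), 0]) :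
    Commute Y parMat := by
  have h00 : Y 0 0 = 1 := by simpa [SL2.smul_apply] using congrFun h 0
  have h10 : Y 1 0 = 0 := by simpa [SL2.smul_apply] using congrFun h 1
  have h11 : Y 1 1 = 1 := by simpa [h00, h10] using Y.det_eq_one
  ext i j
  rw [Matrix.SpecialLinearGroup.coe_mul, Matrix.SpecialLinearGroup.coe_mul, Matrix.mul_apply,
    Matrix.mul_apply, Fin.sum_univ_two, Fin.sum_univ_two]
  fin_cases i <;> fin_cases j <;> simp [parMat, h00, h10, h11, add_comm]

theorem inv_smul_eq_smul_iff {M : SL2 ℝ} {e : Fin 2 → ℝ} {c : ℝ} (hc : c ≠ 0) :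
    M⁻¹ • e = c • e ↔ M • e = c⁻¹ • e := by
  rw [inv_smul_eq_iff, smul_comm, eq_inv_smul_iff₀ hc, eq_comm]

theorem neg_of_smul_smul_eq_smul {R S : SL2 ℝ} {e : Fin 2 → ℝ} {c : ℝ}
    (hRe : 0 < area e (R • e)) (hSe : 0 < area e (S • e)) (h : S • R • e = c • e) : c < 0 := by
  have harea : area e (R • e) = -c * area e (S • e) := by
    rw [← area_smul_smul S, h]
    simp only [area, Pi.smul_apply, smul_eq_mul]
    ring
  rw [harea] at hRe
  linarith [pos_of_mul_pos_left hRe hSe.le]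

namespace SurfaceOnLeft

variable {G : Type} [Group G] {ρ : G →* PSL2 ℝ} {x t : G}

theorem hypLength_nonneg (h : SurfaceOnLeft ρ x) : 0 ≤ hypLength (ρ x) := by
  rcases h with ⟨P, l, hl, hx, -⟩ | ⟨P, hx⟩
  · rw [hx, hypLength_conj_hypMat P hl.le]
    exact hl.le
  · rw [hx, hypLength_conj_parMat P]

theorem exists_lift (h : SurfaceOnLeft ρ x) :
    ∃ X : SL2 ℝ, ρ x = toPSL2 X ∧ X.1.trace = 2 * Real.cosh (hypLength (ρ x) / 2) := by
  rcases h with ⟨P, l, hl, hx, -⟩ | ⟨P, hx⟩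
  · rw [hx, hypLength_conj_hypMat P hl.le]
    exact ⟨_, rfl, trace_conj_hypMat P l⟩
  · rw [hx, hypLength_conj_parMat P]
    exact ⟨_, rfl, by rw [trace_conj_parMat]; simp⟩

theorem exists_eigenvector (hρ : Function.Injective ρ) (ht : SurfaceOnLeft ρ t) :
    ∃ (T : SL2 ℝ) (e : Fin 2 → ℝ), ρ t = toPSL2 T ∧ e ≠ 0 ∧
      T • e = Real.exp (-(hypLength (ρ t) / 2)) • e ∧
      ∀ (x : G) (X : SL2 ℝ), ρ x = toPSL2 X → X • e = e → Commute x t := by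
  rcases ht with ⟨Q, n, hn, ht, hU⟩ | ⟨Q, ht⟩
  · have he : ![(0 : ℝ), 1] ≠ 0 := fun h => one_ne_zero (congrFun h 1)
    refine ⟨_, Q • ![0, 1], ht, (smul_ne_zero_iff_ne _).2 he, ?_, fun x X hX hXe => ?_⟩
    · rw [ht, hypLength_conj_hypMat Q hn.le, mul_smul, mul_smul, inv_smul_smul, hypMat_smul,
        ← smul_comm Q]
      simp
    · by_contra hxt
      have hxt' : x ∉ Subgroup.zpowers t := by
        rintro ⟨k, rfl⟩
        exact hxt ((Commute.refl t).zpow_left k)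
      have := inv_smul_mul_inv_smul_neg (hU x hxt' X hX.symm) ((smul_ne_zero_iff_ne Q).2 he)
        one_ne_zero (hXe.trans (one_smul _ _).symm)
      simp [inv_smul_smul] at this
  · have he : ![(1 : ℝ), 0] ≠ 0 := fun h => one_ne_zero (congrFun h 0)
    refine ⟨_, Q • ![1, 0], ht, (smul_ne_zero_iff_ne _).2 he, ?_, fun x X hX hXe => hρ ?_⟩
    · rw [ht, hypLength_conj_parMat Q, mul_smul, mul_smul, inv_smul_smul, parMat_smul,
        ← smul_comm Q]
      simp
    · have hcomm : Commute (Q⁻¹ * X * Q) parMat := commute_parMat_of_smul_eq (by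
        rw [mul_smul, mul_smul, hXe, inv_smul_smul])
      have hX' : X = Q * (Q⁻¹ * X * Q) * Q⁻¹ := by group
      rw [map_mul, map_mul, hX, ht, hX']
      exact congrArg toPSL2 (hcomm.map (MulAut.conj Q))

theorem area_smul_pos (hx : SurfaceOnLeft ρ x) {X T : SL2 ℝ} (hX : ρ x = toPSL2 X)
    (htr : 0 < X.1.trace) (hT : ρ t = toPSL2 T) (htx : t ∉ Subgroup.zpowers x) {e : Fin 2 → ℝ}
    (he : e ≠ 0) {c : ℝ} (hc : c ≠ 0) (hTe : T • e = c • e) (hXe : X • e ≠ e) :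
    0 < area e (X • e) := by
  rcases hx with ⟨P, l, hl, hx, hU⟩ | ⟨P, hx⟩
  · obtain rfl : X = P * hypMat l * P⁻¹ := eq_of_toPSL2_eq_of_trace_pos (hX.symm.trans hx) htr
      (by rw [trace_conj_hypMat]; positivity)
    have hneg := inv_smul_mul_inv_smul_neg (hU t htx T hT.symm) he hc hTe
    have hexp : Real.exp (-(l / 2)) < Real.exp (l / 2) := Real.exp_lt_exp.2 (by linarith)
    rw [← area_smul_smul P⁻¹, mul_smul, mul_smul, inv_smul_smul, area_hypMat_smul]
    exact mul_pos_of_neg_of_neg (by linarith) hneg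
  · obtain rfl : X = P * parMat * P⁻¹ := eq_of_toPSL2_eq_of_trace_pos (hX.symm.trans hx) htr
      (by rw [trace_conj_parMat]; norm_num)
    rw [← area_smul_smul P⁻¹, mul_smul, mul_smul, inv_smul_smul, area_parMat_smul]
    refine sq_pos_of_ne_zero fun h => hXe ?_
    rw [mul_smul, mul_smul, smul_eq_iff_eq_inv_smul, parMat_smul, h]
    ext i
    fin_cases i <;> simp [h]

end SurfaceOnLeft

namespace IsPantsHolonomy

variable {ρ σ : PantsGroup →* PSL2 ℝ}

theorem exists_eq_conj_normalRep (h : IsPantsHolonomy ρ) : ∃ g : PSL2 ℝ,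
    ρ = (MulAut.conj g).toMonoidHom.comp (normalRep fun i => hypLength (ρ (bdry i))) := by
  obtain ⟨R, hR, hRtr⟩ := (h.left 0).exists_lift
  obtain ⟨S, hS, hStr⟩ := (h.left 1).exists_lift
  obtain ⟨T, e, hT, he, hTe, hfix⟩ := (h.left 2).exists_eigenvector h.faithful
  set c := Real.exp (-(hypLength (ρ (bdry 2)) / 2))
  have hc : 0 < c := Real.exp_pos _
  have hpos {i : Fin 3} (hi : i ≠ 2) {X : SL2 ℝ} (hX : ρ (bdry i) = toPSL2 X)
      (htr : X.1.trace = 2 * Real.cosh (hypLength (ρ (bdry i)) / 2)) : 0 < area e (X • e) := by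
    refine (h.left i).area_smul_pos hX (by rw [htr]; positivity) hT ?_ he hc.ne' hTe
      fun hXe => not_commute_bdry hi (hfix _ X hX hXe)
    rintro ⟨k, hk⟩
    exact not_commute_bdry hi (hk ▸ (Commute.refl (bdry i)).zpow_right k)
  have hRe := hpos (by decide) hR hRtr
  have hSe := hpos (by decide) hS hStr
  refine AdSPants.exists_eq_conj_normalRep hR hS hRtr hStr hRe ?_
  have hTSR : toPSL2 T = toPSL2 (S * R)⁻¹ := by
    rw [← hT, bdry_two_eq, map_inv, map_mul, hR, hS]
    rfl
  have hcinv : Real.exp (hypLength (ρ (bdry 2)) / 2) = c⁻¹ := by rw [← Real.exp_neg, neg_neg]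
  rcases toPSL2_eq_iff.1 hTSR with hinv | hinv
  · have hSRe : S • R • e = c⁻¹ • e := by
      rw [← mul_smul, ← inv_smul_eq_smul_iff hc.ne', hinv, hTe]
    exact absurd (neg_of_smul_smul_eq_smul hRe hSe hSRe) (inv_pos.2 hc).not_gt
  · rw [hcinv, ← inv_neg, ← mul_smul, ← inv_smul_eq_smul_iff (neg_ne_zero.2 hc.ne'), hinv,
      SL2.neg_smul, hTe, neg_smul]

theorem exists_eq_conj (hρ : IsPantsHolonomy ρ) (hσ : IsPantsHolonomy σ)
    (h : ∀ i, hypLength (ρ (bdry i)) = hypLength (σ (bdry i))) :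
    ∃ g : PSL2 ℝ, σ = (MulAut.conj g).toMonoidHom.comp ρ := by
  obtain ⟨a, ha⟩ := hρ.exists_eq_conj_normalRep
  obtain ⟨b, hb⟩ := hσ.exists_eq_conj_normalRep
  simp only [← h] at hb
  generalize normalRep _ = κ at ha hb
  refine ⟨b * a⁻¹, MonoidHom.ext fun y => ?_⟩
  have hay : ρ y = a * κ y * a⁻¹ := DFunLike.congr_fun ha y
  change σ y = b * a⁻¹ * ρ y * (b * a⁻¹)⁻¹
  rw [DFunLike.congr_fun hb y, hay]
  change b * κ y * b⁻¹ = _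
  group

end IsPantsHolonomy

/-! ### The algebra `𝓑` and the group `PSL(2, 𝓑)` -/

section Product

variable {R S T : Type} [CommRing R] [CommRing S] [CommRing T] {f : R →+* S} {g : R →+* T}

theorem bijective_map_prod (h : Function.Bijective (f.prod g)) :
    Function.Bijective ((Matrix.SpecialLinearGroup.map (n := Fin 2) f).prod
      (Matrix.SpecialLinearGroup.map g)) := by
  refine ⟨fun M N hMN => ?_, fun ⟨P, Q⟩ => ?_⟩
  · obtain ⟨hf, hg⟩ := Prod.mk.inj hMN
    ext i j
    refine h.injective (Prod.ext ?_ ?_)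
    · exact congrFun₂ (congrArg Subtype.val hf) i j
    · exact congrFun₂ (congrArg Subtype.val hg) i j
  · choose m hm using fun i j => h.surjective (P i j, Q i j)
    have hf (i j) : f (m i j) = P i j := congrArg Prod.fst (hm i j)
    have hg (i j) : g (m i j) = Q i j := congrArg Prod.snd (hm i j)
    have hdet : (Matrix.of m).det = 1 := by
      refine h.injective (Prod.ext ?_ ?_)
      · simpa [Matrix.det_fin_two, hf] using SL2.det_eq_one P
      · simpa [Matrix.det_fin_two, hg] using SL2.det_eq_one Q
    refine ⟨⟨_, hdet⟩, Prod.ext ?_ ?_⟩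
    · ext i j
      exact hf i j
    · ext i j
      exact hg i j

theorem bijective_mapPSL2_prod (h : Function.Bijective (f.prod g)) :
    Function.Bijective ((mapPSL2 f).prod (mapPSL2 g)) := by
  have hSL := bijective_map_prod h
  refine ⟨(injective_iff_map_eq_one _).2 fun A hA => ?_, fun ⟨A, B⟩ => ?_⟩
  · obtain ⟨M, rfl⟩ := QuotientGroup.mk_surjective A
    obtain ⟨hf, hg⟩ := Prod.mk.inj hA
    have hf := Subgroup.mem_center_iff.1 ((QuotientGroup.eq_one_iff _).1 hf)
    have hg := Subgroup.mem_center_iff.1 ((QuotientGroup.eq_one_iff _).1 hg)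
    refine (QuotientGroup.eq_one_iff M).2 (Subgroup.mem_center_iff.2 fun N => hSL.injective ?_)
    rw [map_mul, map_mul]
    exact Prod.ext (hf _) (hg _)
  · obtain ⟨P, rfl⟩ := QuotientGroup.mk_surjective A
    obtain ⟨Q, rfl⟩ := QuotientGroup.mk_surjective B
    obtain ⟨M, hM⟩ := hSL.surjective (P, Q)
    exact ⟨toPSL2 M, congrArg (Prod.map toPSL2 toPSL2) hM⟩

variable [TopologicalSpace R] [TopologicalSpace S] [TopologicalSpace T]

theorem isHomeomorph_map_prod (h : IsHomeomorph (f.prod g)) :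
    IsHomeomorph ((Matrix.SpecialLinearGroup.map (n := Fin 2) f).prod
      (Matrix.SpecialLinearGroup.map g)) := by
  have hbij := bijective_map_prod h.bijective
  have hcont : Continuous ((Matrix.SpecialLinearGroup.map (n := Fin 2) f).prod
      (Matrix.SpecialLinearGroup.map g)) :=
    (Continuous.specialLinearGroup_map (continuous_fst.comp h.continuous)).prodMk
      (Continuous.specialLinearGroup_map (continuous_snd.comp h.continuous))
  have hzip : Continuous fun M : SL2 S × SL2 T => Matrix.of fun i j => (M.1 i j, M.2 i j) :=
    continuous_matrix fun i j =>
      ((continuous_subtype_val.comp continuous_fst).matrix_elem i j).prodMk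
        ((continuous_subtype_val.comp continuous_snd).matrix_elem i j)
  exact isHomeomorph_iff_isEmbedding_surjective.2
    ⟨⟨.of_comp hcont hzip (h.isInducing.matrix_map.comp .subtypeVal), hbij.injective⟩,
      hbij.surjective⟩

theorem isHomeomorph_mapPSL2_prod [IsTopologicalRing S] [IsTopologicalRing T]
    (h : IsHomeomorph (f.prod g)) : IsHomeomorph ((mapPSL2 f).prod (mapPSL2 g)) := by
  have hmk : IsQuotientMap (((mapPSL2 f).prod (mapPSL2 g)) ∘ toPSL2) :=
    (QuotientGroup.isOpenQuotientMap_mk.prodMap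
      QuotientGroup.isOpenQuotientMap_mk).isQuotientMap.comp (isHomeomorph_map_prod h).isQuotientMap
  exact isHomeomorph_iff_isQuotientMap_injective.2
    ⟨.of_comp continuous_quot_mk (isQuotientMap_quot_mk.continuous_iff.2 hmk.continuous) hmk,
      (bijective_mapPSL2_prod h.bijective).injective⟩

end Product

/-- The isomorphism `a e⁺ + b e⁻ ↦ (a, b)` of `𝓑` with `ℝ × ℝ`, as a homeomorphism. -/
def coordHomeomorph : BAlg ≃ₜ ℝ × ℝ where
  toFun := coordPlus.prod coordMinus
  invFun p := ⟨(p.1 + p.2) / 2, (p.1 - p.2) / 2⟩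
  left_inv z := by
    change (⟨(z.re + z.im + (z.re - z.im)) / 2, (z.re + z.im - (z.re - z.im)) / 2⟩ : BAlg) = z
    ext <;> ring
  right_inv p := by
    change ((p.1 + p.2) / 2 + (p.1 - p.2) / 2, (p.1 + p.2) / 2 - (p.1 - p.2) / 2) = p
    ext <;> ring
  continuous_toFun :=
    (by fun_prop : Continuous fun p : ℝ × ℝ => (p.1 + p.2, p.1 - p.2)).comp
      (continuous_induced_dom (f := fun z : BAlg => (z.re, z.im)))
  continuous_invFun := continuous_induced_rng.2
    (by fun_prop : Continuous fun p : ℝ × ℝ => ((p.1 + p.2) / 2, (p.1 - p.2) / 2))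

theorem continuous_coordPlus : Continuous coordPlus :=
  continuous_fst.comp coordHomeomorph.continuous

theorem continuous_coordMinus : Continuous coordMinus :=
  continuous_snd.comp coordHomeomorph.continuous

theorem conePlus_eq_preimage :
    conePlus = coordHomeomorph ⁻¹' Set.Ioi 0 ×ˢ Set.Ioi 0 := by
  ext z
  have hnorm : QuadraticAlgebra.norm z = (z.re + z.im) * (z.re - z.im) := by
    simp only [QuadraticAlgebra.norm_def]
    ring
  change 0 < z.re ∧ 0 < QuadraticAlgebra.norm z ↔ 0 < z.re + z.im ∧ 0 < z.re - z.im
  rw [hnorm]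
  refine ⟨fun ⟨hre, hmul⟩ => ?_, fun ⟨hp, hm⟩ => ⟨by linarith, mul_pos hp hm⟩⟩
  rcases pos_and_pos_or_neg_and_neg_of_mul_pos hmul with h | h
  · exact h
  · linarith [hre]

theorem mem_closure_conePlus_iff {z : BAlg} :
    z ∈ closure conePlus ↔ 0 ≤ coordPlus z ∧ 0 ≤ coordMinus z := by
  rw [conePlus_eq_preimage, ← coordHomeomorph.preimage_closure, closure_prod_eq, closure_Ioi]
  rfl

/-- The decomposition `A⁺ e⁺ + A⁻ e⁻ ↦ (A⁺, A⁻)` of `PSL(2, 𝓑)`, as an isomorphism of topological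
groups. -/
def projEquiv : PSL2 BAlg ≃ₜ* PSL2 ℝ × PSL2 ℝ where
  __ := (isHomeomorph_mapPSL2_prod coordHomeomorph.isHomeomorph).homeomorph
  map_mul' := map_mul (projPlus.prod projMinus)

theorem projPlus_projEquiv_symm (p : PSL2 ℝ × PSL2 ℝ) : projPlus (projEquiv.symm p) = p.1 :=
  congrArg Prod.fst (projEquiv.apply_symm_apply p)

theorem projMinus_projEquiv_symm (p : PSL2 ℝ × PSL2 ℝ) : projMinus (projEquiv.symm p) = p.2 :=
  congrArg Prod.snd (projEquiv.apply_symm_apply p)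

/-! ### The length map and its inverse -/

theorem continuous_firstMat : Continuous firstMat :=
  continuous_induced_rng.2 (continuous_matrix fun i j => by
    match i, j with
    | 0, 0 => exact continuous_const
    | 0, 1 => exact continuous_const
    | 1, 0 => exact continuous_const
    | 1, 1 => exact (by fun_prop : Continuous fun l : ℝ => 2 * Real.cosh (l / 2)))

theorem continuous_secondMat {X : Type*} [TopologicalSpace X] {m n : X → ℝ} (hm : Continuous m)
    (hn : Continuous n) : Continuous fun x => secondMat (m x) (n x) :=
  continuous_induced_rng.2 (continuous_matrix fun i j => by
    match i, j with
    | 0, 0 => exact (by fun_prop : Continuous fun x => 2 * Real.cosh (m x / 2))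
    | 0, 1 => exact (by fun_prop : Continuous fun x => -Real.exp (n x / 2))
    | 1, 0 => exact (by fun_prop : Continuous fun x => Real.exp (-(n x / 2)))
    | 1, 1 => exact continuous_const)

theorem continuous_normalRep (y : PantsGroup) : Continuous fun L => normalRep L y := by
  have hmk : Continuous (toPSL2 : SL2 ℝ → PSL2 ℝ) := continuous_quot_mk
  refine continuous_pantsGroup_hom_apply (φ := normalRep) ?_ ?_ y
  · simp only [normalRep_bdry_zero]
    exact hmk.comp (continuous_firstMat.comp (continuous_apply 0))
  · simp only [normalRep_bdry_one]
    exact hmk.comp (continuous_secondMat (by fun_prop) (by fun_prop))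

/-- The representation of the pants group in `PSL(2, 𝓑)` with boundary `𝓑`-lengths `L`, whose two
components are in normal form. -/
def normalRepB (L : Fin 3 → BAlg) : PantsGroup →* PSL2 BAlg :=
  projEquiv.symm.toMonoidHom.comp
    ((normalRep fun i => coordPlus (L i)).prod (normalRep fun i => coordMinus (L i)))

theorem projPlus_comp_normalRepB (L : Fin 3 → BAlg) :
    projPlus.comp (normalRepB L) = normalRep fun i => coordPlus (L i) :=
  MonoidHom.ext fun _ => projPlus_projEquiv_symm _

theorem projMinus_comp_normalRepB (L : Fin 3 → BAlg) :
    projMinus.comp (normalRepB L) = normalRep fun i => coordMinus (L i) :=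
  MonoidHom.ext fun _ => projMinus_projEquiv_symm _

theorem continuous_normalRepB (y : PantsGroup) : Continuous fun L => normalRepB L y := by
  have hplus : Continuous fun (L : Fin 3 → BAlg) i => coordPlus (L i) :=
    continuous_pi fun i => continuous_coordPlus.comp (continuous_apply i)
  have hminus : Continuous fun (L : Fin 3 → BAlg) i => coordMinus (L i) :=
    continuous_pi fun i => continuous_coordMinus.comp (continuous_apply i)
  exact projEquiv.symm.continuous.comp
    (((continuous_normalRep y).comp hplus).prodMk ((continuous_normalRep y).comp hminus))

theorem isHyp_conj_hypMat (P : SL2 ℝ) {l : ℝ} (hl : 0 < l) :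
    IsHyp (toPSL2 (P * hypMat l * P⁻¹)) := by
  refine ⟨_, rfl, ?_⟩
  rw [Matrix.IsHyperbolic, Matrix.discr_fin_two, trace_conj_hypMat,
    Matrix.SpecialLinearGroup.det_coe]
  nlinarith [Real.one_lt_cosh.2 (half_pos hl).ne']

theorem isPar_conj_parMat (P : SL2 ℝ) : IsPar (toPSL2 (P * parMat * P⁻¹)) := by
  refine ⟨_, rfl, ?_⟩
  have hconj : (P * parMat * P⁻¹).1 = (P : Matrix.GeneralLinearGroup (Fin 2) ℝ).1 * parMat.1 *
      (P : Matrix.GeneralLinearGroup (Fin 2) ℝ).1⁻¹ := by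
    rw [← Matrix.coe_units_inv]
    rfl
  rw [hconj, Matrix.isParabolic_conj_iff, Matrix.isParabolic_iff_of_upperTriangular rfl]
  norm_num [parMat]

namespace SurfaceOnLeft

variable {G : Type} [Group G] {ρ : G →* PSL2 ℝ} {x : G}

theorem isHyp_or_isPar (h : SurfaceOnLeft ρ x) : IsHyp (ρ x) ∨ IsPar (ρ x) := by
  rcases h with ⟨P, l, hl, hx, -⟩ | ⟨P, hx⟩
  · exact .inl (hx ▸ isHyp_conj_hypMat P hl)
  · exact .inr (hx ▸ isPar_conj_parMat P)

theorem two_le_absTrace (h : SurfaceOnLeft ρ x) : 2 ≤ absTrace (ρ x) := by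
  obtain ⟨X, hX, htr⟩ := h.exists_lift
  rw [hX]
  exact (two_le_two_mul_cosh _).trans (htr.symm.le.trans (le_abs_self _))

end SurfaceOnLeft

theorem isAdmissible_normalRepB {L : Fin 3 → BAlg} (hL : ∀ i, L i ∈ closure conePlus) :
    IsAdmissible (normalRepB L) := by
  have hL := fun i => mem_closure_conePlus_iff.1 (hL i)
  have hplus : IsPantsHolonomy (projPlus.comp (normalRepB L)) :=
    projPlus_comp_normalRepB L ▸ isPantsHolonomy_normalRep fun i => (hL i).1
  have hminus : IsPantsHolonomy (projMinus.comp (normalRepB L)) :=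
    projMinus_comp_normalRepB L ▸ isPantsHolonomy_normalRep fun i => (hL i).2
  refine ⟨fun i => ?_, hplus, hminus⟩
  have hp := (hplus.left i).isHyp_or_isPar
  have hm := (hminus.left i).isHyp_or_isPar
  simp only [MonoidHom.comp_apply] at hp hm
  unfold IsLoxodromic IsSemiLoxodromic IsParabolicB
  tauto

theorem continuous_absTrace : Continuous absTrace :=
  continuous_quot_lift _ (continuous_abs.comp continuous_subtype_val.matrix_trace)

theorem continuous_hypLength_of_surfaceOnLeft {X G : Type} [TopologicalSpace X] [Group G]
    {ρ : X → G →* PSL2 ℝ} {x : G} (hρ : Continuous fun a => ρ a x)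
    (h : ∀ a, SurfaceOnLeft (ρ a) x) : Continuous fun a => hypLength (ρ a x) := by
  refine continuous_const.mul (Real.continuousOn_arcosh.comp_continuous
    ((continuous_absTrace.comp hρ).div_const 2) fun a => ?_)
  rw [Set.mem_Ici, le_div_iff₀ two_pos, one_mul]
  exact (h a).two_le_absTrace

theorem coordPlus_bLength (A : PSL2 BAlg) : coordPlus (bLength A) = hypLength (projPlus A) :=
  congrArg Prod.fst (coordHomeomorph.apply_symm_apply (_, _))

theorem coordMinus_bLength (A : PSL2 BAlg) : coordMinus (bLength A) = hypLength (projMinus A) :=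
  congrArg Prod.snd (coordHomeomorph.apply_symm_apply (_, _))

theorem bLength_conj (g A : PSL2 BAlg) : bLength (g * A * g⁻¹) = bLength A := by
  simp only [bLength, map_mul, map_inv, hypLength_conj]

theorem bLength_normalRepB_bdry {L : Fin 3 → BAlg} (hL : ∀ i, L i ∈ closure conePlus) (i : Fin 3) :
    bLength (normalRepB L (bdry i)) = L i := by
  have hL := fun i => mem_closure_conePlus_iff.1 (hL i)
  refine coordHomeomorph.injective (Prod.ext ?_ ?_)
  · refine (coordPlus_bLength _).trans ?_
    rw [← MonoidHom.comp_apply, projPlus_comp_normalRepB,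
      hypLength_normalRep_bdry fun i => (hL i).1]
    rfl
  · refine (coordMinus_bLength _).trans ?_
    rw [← MonoidHom.comp_apply, projMinus_comp_normalRepB,
      hypLength_normalRep_bdry fun i => (hL i).2]
    rfl

namespace AdmHom

theorem bLength_mem_closure (ρ : AdmHom) (i : Fin 3) :
    bLength (ρ.1 (bdry i)) ∈ closure conePlus := by
  rw [mem_closure_conePlus_iff, coordPlus_bLength, coordMinus_bLength]
  exact ⟨(ρ.2.plus.left i).hypLength_nonneg, (ρ.2.minus.left i).hypLength_nonneg⟩

theorem continuous_apply (x : PantsGroup) : Continuous fun ρ : AdmHom => ρ.1 x :=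
  (_root_.continuous_apply x).comp continuous_induced_dom

theorem continuous_bLength_bdry (i : Fin 3) :
    Continuous fun ρ : AdmHom => bLength (ρ.1 (bdry i)) := by
  have hproj := projEquiv.continuous.comp (AdmHom.continuous_apply (bdry i))
  exact coordHomeomorph.symm.continuous.comp
    ((continuous_hypLength_of_surfaceOnLeft (ρ := fun ρ : AdmHom => projPlus.comp ρ.1)
      (continuous_fst.comp hproj) fun ρ => ρ.2.plus.left i).prodMk
    (continuous_hypLength_of_surfaceOnLeft (ρ := fun ρ : AdmHom => projMinus.comp ρ.1)
      (continuous_snd.comp hproj) fun ρ => ρ.2.minus.left i))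

theorem exists_eq_conj {ρ σ : AdmHom}
    (h : ∀ i, bLength (ρ.1 (bdry i)) = bLength (σ.1 (bdry i))) :
    ∃ g : PSL2 BAlg, ∀ x, σ.1 x = g * ρ.1 x * g⁻¹ := by
  obtain ⟨a, ha⟩ := ρ.2.plus.exists_eq_conj σ.2.plus fun i => by
    simp only [MonoidHom.comp_apply, ← coordPlus_bLength, h]
  obtain ⟨b, hb⟩ := ρ.2.minus.exists_eq_conj σ.2.minus fun i => by
    simp only [MonoidHom.comp_apply, ← coordMinus_bLength, h]
  refine ⟨projEquiv.symm (a, b), fun x => projEquiv.injective ?_⟩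
  rw [map_mul, map_mul, map_inv, ContinuousMulEquiv.apply_symm_apply]
  exact Prod.ext (DFunLike.congr_fun ha x) (DFunLike.congr_fun hb x)

/-- The admissible representation in normal form with given boundary `𝓑`-lengths. -/
def ofLengths (L : Fin 3 → closure conePlus) : AdmHom :=
  ⟨normalRepB fun i => L i, isAdmissible_normalRepB fun i => (L i).2⟩

theorem continuous_ofLengths : Continuous ofLengths := by
  have hL : Continuous fun (L : Fin 3 → closure conePlus) i => (L i : BAlg) := by fun_prop
  exact continuous_induced_rng.2 (continuous_pi fun y => (continuous_normalRepB y).comp hL)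

end AdmHom

/-- The map sending a conjugacy class of admissible representations to its boundary
`𝓑`-lengths. -/
def boundaryLengths : AdmModuli → Fin 3 → closure conePlus :=
  Quotient.lift (fun ρ i => ⟨bLength (ρ.1 (bdry i)), ρ.bLength_mem_closure i⟩)
    fun ρ _ ⟨g, hg⟩ => funext fun i => Subtype.ext
      ((bLength_conj g (ρ.1 (bdry i))).symm.trans (congrArg bLength (hg (bdry i)).symm))

theorem continuous_boundaryLengths : Continuous boundaryLengths :=
  continuous_quot_lift _
    (continuous_pi fun i => (AdmHom.continuous_bLength_bdry i).subtype_mk _)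

theorem boundaryLengths_injective : Function.Injective boundaryLengths := by
  rintro ⟨ρ⟩ ⟨σ⟩ h
  exact Quotient.sound (AdmHom.exists_eq_conj fun i => congrArg Subtype.val (congrFun h i))

theorem boundaryLengths_ofLengths (L : Fin 3 → closure conePlus) :
    boundaryLengths (Quotient.mk _ (AdmHom.ofLengths L)) = L :=
  funext fun i => Subtype.ext (bLength_normalRepB_bdry (fun i => (L i).2) i)

/-- The boundary `𝓑`-lengths, as a homeomorphism. -/
def boundaryLengthsHomeomorph : AdmModuli ≃ₜ (Fin 3 → closure conePlus) where
  toFun := boundaryLengths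
  invFun L := Quotient.mk _ (AdmHom.ofLengths L)
  left_inv _ := boundaryLengths_injective (boundaryLengths_ofLengths _)
  right_inv := boundaryLengths_ofLengths
  continuous_toFun := continuous_boundaryLengths
  continuous_invFun := continuous_quot_mk.comp AdmHom.continuous_ofLengths

end AdSPants

end

theorem mainTheorem5 :
    ∃ F : AdSPants.AdmModuli ≃ₜ (Fin 3 → closure AdSPants.conePlus),
      ∀ (ρ : AdSPants.AdmHom) (i : Fin 3),
        (F (Quotient.mk AdSPants.conjSetoid ρ) i : AdSPants.BAlg) =
          AdSPants.bLength (ρ.1 (AdSPants.bdry i)) :=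
  ⟨AdSPants.boundaryLengthsHomeomorph, fun _ _ => rfl⟩
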